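/- **Definitions.** An *oriented abelian group* is an abelian group $A$ with a ternary relation $\mathcal O$, holding only of triples of distinct elements, which is cyclic ($\mathcal O(a,b,c)\Rightarrow\mathcal O(b,c,a)$), invariant under translations, and such that $x<_0y :\Leftrightarrow \mathcal O(0,x,y)$ is a strict linear order on $A\setminus\{0\}$. It is *regularly dense* if for every prime $p$ and all $a,b\in A$ with $\mathcal O(0,a,b)$ there is $c\in A$ with $\mathcal O(a,pc,b)$ and $ic<_0(i+1)c$ for $1\le i\le p-1$. For a prime $p$, let $[p]A=|A/pA|$, and let $e(A,p)$ be the least $j\in\mathbb N$ with $\operatorname{Tor}_{p^{j+k}}(A)=\operatorname{Tor}_{p^{j}}(A)$ for all $k\in\mathbb N$, where $\operatorname{Tor}_{n}(A)=\{a\in A: na=0\}$, and $e(A,p)=\infty$ if there is no such $j$. For families $\vec d=(d_p)_p$ and $\vec e=(e_p)_p$ in $\mathbb N\cup\{\infty\}$ indexed by the primes, $T(\vec d,\vec e)$ is the theory, in the language $L_{\mathcal O}=\{+,-,0,\mathcal O\}$, of the regularly dense oriented abelian groups $A$ with $[p]A=p^{d_p}$ (infinite if $d_p=\infty$) and $e(A,p)=e_p$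 for every prime $p$. In the language $L_{\mathcal O}^p=L_{\mathcal O}\cup\{V\}$ with a unary predicate $V$ interpreted as $G$, $T\big((\vec d_1,\vec e_1),(\vec d_2,\vec e_2)\big)$ is the theory whose models are the pairs $(A,G)$ such that $A\models T(\vec d_1,\vec e_1)$, $G$ is a dense subgroup of $A$ (it meets every nonempty interval $\{x:\mathcal O(a,x,b)\}$), $G\models T(\vec d_2,\vec e_2)$, and $A/G$ is infinite. Write $\vec 0$ and $\vec\infty$ for the constant families. Let $T$ be a first-order theory and $d\in\mathbb N$. A finite set $\Delta(x;\vec y)$ of partitioned formulas, with a single object variable $x$, has *uniform definability of types over finite sets (UDTFS) in $T$ with $d$ parameters* if there are finitely many families $F_i=(F_{i,\varphi}(\vec y;\vec y_1,\dots,\vec y_d))_{\varphi\in\Delta}$ ($i\in I$) of formulas such that for every model $M$ of $T$, every nonempty finite $B\subseteq M^{|\vec y|}$ and every $a\in M$ there are $i\in I$ and $\vec b_1,\dots,\vec b_d\in B$ with $$M\models\varphi(a;\vec b)\iff M\models F_{i,\varphi}(\vec b;\vec b_1,\dots,\vec b_d)\qquad\text{for all }\varphi\in\Delta,\ \vec b\in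 B.$$ $T$ has the *VC $d$ property* if every finite set $\Delta(x;\vec y)$ of partitioned formulas in a single object variable has UDTFS in $T$ with $d$ parameters. **Theorem.** The $L_{\mathcal O}^p$-theories $T\big((\vec 0,\vec 0),(\vec 0,\vec 0)\big)$ and $T\big((\vec 0,\vec\infty),(\vec 0,\vec e)\big)$, for $\vec e\in\{\vec 0,\vec\infty\}$, have the VC $2$ property. -/

import Mathlib

open FirstOrder FirstOrder.Language

/-! ### The VC `d` property of a first-order theory -/

section VCProperty

universe u v w

variable {L : FirstOrder.Language.{u, v}}

/-- `Δ(x; y)` is a finite set of partitioned formulas in the single object variable `x`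
(the variable `Sum.inl ()`) and the parameter variables `y = (y_0, …, y_{n-1})` (the variables
`Sum.inr j`).  It has *uniform definability of types over finite sets (UDTFS) with `d` parameters*
in the theory `T` if there are finitely many families
`F_i = (F_i(φ)(y; y_1, …, y_d))_{φ ∈ Δ}`, `i < N`, of formulas such that in every model `M` of `T`,
for every nonempty finite set `B` of parameter tuples, each `Δ`-type over `B` is defined by one of
the `F_i` with the `y_k` replaced by `d` elements of `B`.  (`Δ` and `B` being finite, a complete
`Δ`-type over `B` that is consistent with `Th(M, B)` is realised in `M`, so the types over `B` are
exactly the types of the elements `a` of `M`.)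

In a defining formula the variables `Sum.inl j` are those of `y` and the
variables `Sum.inr (k, j)` are those of `y_k`. -/
def HasUDTFS (T : L.Theory) {n : ℕ} (Δ : Finset (L.Formula (Unit ⊕ Fin n))) (d : ℕ) : Prop :=
  ∃ (N : ℕ) (F : Fin N → L.Formula (Unit ⊕ Fin n) → L.Formula (Fin n ⊕ (Fin d × Fin n))),
    ∀ (M : Type w) [L.Structure M] [M ⊨ T] (B : Set (Fin n → M)), B.Finite → B.Nonempty →
      ∀ a : M, ∃ (i : Fin N) (c : Fin d → (Fin n → M)), (∀ k, c k ∈ B) ∧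
        ∀ φ ∈ Δ, ∀ b ∈ B,
          (φ.Realize (Sum.elim (fun _ => a) b) ↔
            (F i φ).Realize (Sum.elim b (fun kj => c kj.1 kj.2)))

/-- The theory `T` has the *VC `d` property*: every finite set of partitioned formulas in a single
object variable has UDTFS in `T` with `d` parameters. -/
def HasVCProperty (T : L.Theory) (d : ℕ) : Prop :=
  ∀ (n : ℕ) (Δ : Finset (L.Formula (Unit ⊕ Fin n))), HasUDTFS.{u, v, w} T Δ d

end VCProperty

namespace OrientedGroup

/-! ### The language of oriented abelian groups -/

/-- The function symbols `0`, `-`, `+`. -/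
inductive OFunc : ℕ → Type
  | zero : OFunc 0
  | neg : OFunc 1
  | add : OFunc 2

/-- The relation symbol `𝒪` (ternary). -/
inductive ORel : ℕ → Type
  | orient : ORel 3

/-- The language `{+, -, 0, 𝒪}` of oriented abelian groups. -/
abbrev LO : FirstOrder.Language.{0, 0} := ⟨OFunc, ORel⟩

instance {α : Type*} : Zero (LO.Term α) :=
  ⟨Constants.term (L := LO) OFunc.zero⟩

instance {α : Type*} : Neg (LO.Term α) :=
  ⟨fun t => Functions.apply₁ (L := LO) OFunc.neg t⟩

instance {α : Type*} : Add (LO.Term α) :=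
  ⟨fun s t => Functions.apply₂ (L := LO) OFunc.add s t⟩

/-- The term `k t = (⋯((0 + t) + t) + ⋯) + t`. -/
def mulTerm {α : Type*} : ℕ → LO.Term α → LO.Term α
  | 0, _ => 0
  | k + 1, t => mulTerm k t + t

/-- The formula `𝒪(r, s, t)`. -/
def orient {α : Type*} {n : ℕ} (r s t : LO.Term (α ⊕ Fin n)) : LO.BoundedFormula α n :=
  Relations.boundedFormula (L := LO) ORel.orient ![r, s, t]

/-! ### The theory `T(d, e)` of regularly dense oriented abelian groups -/

/-- Oriented abelian groups: abelian groups with a cyclic translation-invariant ternary relation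
`𝒪` (holding only of triples of distinct elements) such that `x <₀ y :⇔ 𝒪(0, x, y)` is a strict
linear order on the nonzero elements. -/
def orientedAxioms : LO.Theory :=
  { -- abelian groups
    ∀' ∀' ∀' (((&0 + &1) + &2) =' (&0 + (&1 + &2))),
    ∀' ∀' ((&0 + &1) =' (&1 + &0)),
    ∀' (((0 : LO.Term _) + &0) =' &0),
    ∀' ((-&0 + &0) =' (0 : LO.Term _)),
    -- `𝒪` is cyclic
    ∀' ∀' ∀' (orient (&0) (&1) (&2) ⟹ orient (&1) (&2) (&0)),
    -- `𝒪` is preserved by translations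
    ∀' ∀' ∀' ∀' (orient (&0) (&1) (&2) ⟹ orient (&0 + &3) (&1 + &3) (&2 + &3)),
    -- `𝒪` holds only of distinct elements; together with cyclicity and translation invariance
    -- it suffices to say this for triples `(0, x, y)`
    ∀' ∀' (orient 0 (&0) (&1) ⟹ (∼(&0 =' 0) ⊓ ∼(&1 =' 0) ⊓ ∼(&0 =' &1))),
    -- `<₀` is transitive
    ∀' ∀' ∀' (orient 0 (&0) (&1) ⟹ orient 0 (&1) (&2) ⟹ orient 0 (&0) (&2)),
    -- `<₀` is linear on the nonzero elements
    ∀' ∀' (∼(&0 =' 0) ⟹ ∼(&1 =' 0) ⟹ ∼(&0 =' &1) ⟹ (orient 0 (&0) (&1) ⊔ orient 0 (&1) (&0))) }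

/-- Regular density at `p`: for all `a, b` with `𝒪(0, a, b)` there is `c` with `𝒪(a, pc, b)` and
`ic <₀ (i+1)c` for `1 ≤ i ≤ p - 1`. -/
noncomputable def regularlyDenseAt (p : ℕ) : LO.Sentence :=
  ∀' ∀' (orient 0 (&0) (&1) ⟹
    ∃' (orient (&0) (mulTerm p (&2)) (&1) ⊓
      BoundedFormula.iInf fun i : {i : ℕ // i ∈ Finset.Icc 1 (p - 1)} =>
        orient 0 (mulTerm i (&2)) (mulTerm (i + 1) (&2))))

/-- The sentence saying that `A / pA` has at least `m` elements: there are `x_0, …, x_{m-1}` with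
`x_i - x_j ∉ pA` for `i ≠ j`. -/
noncomputable def quotientAtLeast (p m : ℕ) : LO.Sentence :=
  (BoundedFormula.iInf fun ij : {ij : Fin m × Fin m // ij.1 ≠ ij.2} =>
    ∼(∃' ((&(ij.1.1.castSucc) + -&(ij.1.2.castSucc)) =' mulTerm p (&(Fin.last m)))) :
      LO.BoundedFormula Empty m).exs

/-- The sentence saying that `Tor_{p^(j+1)}(A) = Tor_{p^j}(A)` (the inclusion `⊇` is clear). -/
def torsionStableAt (p j : ℕ) : LO.Sentence :=
  ∀' ((mulTerm (p ^ (j + 1)) (&0) =' (0 : LO.Term _)) ⟹ (mulTerm (p ^ j) (&0) =' (0 : LO.Term _)))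

open Classical in
/-- The `L_𝒪`-theory `T(d, e)` of the regularly dense oriented abelian groups `A` such that for
every prime `p` the group `A / pA` has `p ^ d_p` elements (infinitely many if `d_p = ∞`), and
`e(A, p) = e_p`, where `e(A, p)` is the least `j` from which on the chain `Tor_{p^0}(A) ≤
Tor_{p^1}(A) ≤ ⋯` is constant, and `∞` if there is no such `j`. -/
noncomputable def groupTheory (d e : Nat.Primes → ℕ∞) : LO.Theory :=
  orientedAxioms ∪
  {φ | ∃ p : Nat.Primes, φ = regularlyDenseAt p} ∪
  {φ | ∃ (p : Nat.Primes) (m : ℕ),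
    φ = if (m : ℕ∞) ≤ ((p : ℕ) : ℕ∞) ^ d p then quotientAtLeast p m
      else ∼(quotientAtLeast p m)} ∪
  {φ | ∃ (p : Nat.Primes) (j : ℕ),
    φ = if e p ≤ (j : ℕ∞) then torsionStableAt p j else ∼(torsionStableAt p j)}

/-! ### Pairs -/

/-- The unary relation symbol `V`. -/
inductive VRel : ℕ → Type
  | V : VRel 1

/-- The language `{V}`. -/
abbrev LV : FirstOrder.Language.{0, 0} := ⟨fun _ => Empty, VRel⟩

/-- The language `{+, -, 0, 𝒪, V}` of pairs of oriented abelian groups. -/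
abbrev LOP : FirstOrder.Language.{0, 0} := LO.sum LV

/-- The relation symbol `V` in the language of pairs. -/
abbrev symbV : LOP.Relations 1 := Sum.inr VRel.V

/-- An `L_𝒪`-formula as a formula of the language of pairs. -/
def lift {α : Type*} {n : ℕ} (φ : LO.BoundedFormula α n) : LOP.BoundedFormula α n :=
  LHom.sumInl.onBoundedFormula φ

/-- The formula `V(t)`. -/
def inV {α : Type*} {n : ℕ} (t : LO.Term (α ⊕ Fin n)) : LOP.BoundedFormula α n :=
  Relations.boundedFormula₁ symbV (LHom.sumInl.onTerm t)

/-- The `V`-restriction of an `L_𝒪`-formula: all quantifiers are restricted to `V`. -/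
def restrictV {α : Type*} : {n : ℕ} → LO.BoundedFormula α n → LOP.BoundedFormula α n
  | _, .falsum => .falsum
  | _, .equal s t => lift (.equal s t)
  | _, .rel R ts => lift (.rel R ts)
  | _, .imp φ ψ => (restrictV φ).imp (restrictV ψ)
  | n, .all φ => ∀' (inV (&(Fin.last n)) ⟹ restrictV φ)

/-- `V` is (the underlying set of) a subgroup, and it is dense: it meets each nonempty orientation
interval `(a, b)_𝒪 = {x | 𝒪(a, x, b)}`. -/
def denseSubgroupAxioms : LOP.Theory :=
  { inV (0 : LO.Term _),
    ∀' (inV (&0) ⟹ inV (-(&0 : LO.Term _))),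
    ∀' ∀' (inV (&0) ⟹ inV (&1) ⟹ inV ((&0 : LO.Term _) + &1)),
    ∀' ∀' ((∃' (lift (orient (&0) (&2) (&1)))) ⟹
      (∃' (inV (&2) ⊓ lift (orient (&0) (&2) (&1))))) }

/-- The sentence saying that `A / G` has at least `m` elements: there are `x_0, …, x_{m-1}` with
`x_i - x_j ∉ G` for `i ≠ j`. -/
noncomputable def indexAtLeast (m : ℕ) : LOP.Sentence :=
  (BoundedFormula.iInf fun ij : {ij : Fin m × Fin m // ij.1 ≠ ij.2} =>
    ∼(inV ((&ij.1.1 : LO.Term _) + -&ij.1.2)) : LOP.BoundedFormula Empty m).exs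

/-- The theory `T((d₁, e₁), (d₂, e₂))` of the pairs `(A, G)` such that `A` is a model of
`T(d₁, e₁)`, `G` is a dense subgroup of `A` that is a model of `T(d₂, e₂)`, and `A / G` is
infinite. -/
noncomputable def pairTheory (d₁ e₁ d₂ e₂ : Nat.Primes → ℕ∞) : LOP.Theory :=
  LHom.sumInl.onTheory (groupTheory d₁ e₁) ∪
  denseSubgroupAxioms ∪
  restrictV '' groupTheory d₂ e₂ ∪
  Set.range indexAtLeast

end OrientedGroup

/-! An oriented abelian group unrolls to its universal cover, an ordered abelian group with a
positive unit `u`, and is recovered from it as the quotient by the multiples of `u`, with `[0, u)`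
as fundamental domain. The divisible hull of the cover is an ordered rational vector space. In it
lie two subgroups: the cover `U` and the preimage of the distinguished subgroup, written `G` here.
Since all quotients by `p` are trivial, both are divisible up to multiples of `u`; regular density
makes `G` dense in the hull, and `G` has infinite index in `U` (`IsDenseOrientedPair.isDensePair`).

In such a structure there is a form of quantifier elimination: the truth of a formula at a tuple
depends only on the signs of finitely many rational affine forms and on their membership in `U` and
`G`. The quantifier step is `exists_extension_forms`, the induction on formulas is
`exists_forms_formula`; both choose the forms before the model.

For a single object variable `x`, dividing a form by its coefficient of `x` gives `x + s` with `s`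
depending on the parameters. Sign conditions then define final segments, which form a chain.
Membership in `G` reduces to finitely many conditions saying that `x` lies in a certain coset of the
one subgroup `N G`, so the sets defined are pairwise equal or disjoint. Membership in `U` is
governed by the residue of `x` modulo `N U`, which involves no parameters. One parameter locates the
least member of the chain containing a given element and another locates its coset
(`hasUDTFS_two_of_chain_of_classes`), whence the bound 2. These conditions are first-order because
the winding number of an integral combination is definable (`isDefinableForm`). -/

/-! ### Affine forms and dense pairs of subgroups in ordered rational vector spaces -/

/-- An affine form `∑ cᵢ vᵢ + q u` with rational coefficients, where `u` is a fixed unit. -/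
abbrev AffForm (ι : Type*) := (ι → ℚ) × ℚ

namespace AffForm

variable {ι E : Type*} [Fintype ι] [AddCommGroup E] [Module ℚ E]

/-- The value of an affine form. -/
noncomputable def eval (u : E) (v : ι → E) : AffForm ι →ₗ[ℚ] E :=
  (Fintype.linearCombination ℚ v).coprod (LinearMap.toSpanSingleton ℚ E u)

theorem eval_apply (u : E) (v : ι → E) (l : AffForm ι) :
    eval u v l = ∑ i, l.1 i • v i + l.2 • u := by
  simp [eval, Fintype.linearCombination_apply]

@[simp]
theorem eval_unit (u : E) (v : ι → E) (q : ℚ) : eval u v ((0, q) : AffForm ι) = q • u := by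
  simp [eval_apply]

end AffForm

/-- Two elements of an ordered group have the same sign and lie in the same ones of the two
subgroups `U` and `G`. -/
structure SameType {E : Type*} [AddCommGroup E] [LinearOrder E] (U G : AddSubgroup E) (a b : E) :
    Prop where
  pos : 0 < a ↔ 0 < b
  neg : a < 0 ↔ b < 0
  memU : a ∈ U ↔ b ∈ U
  memG : a ∈ G ↔ b ∈ G

/-- Subgroups `G ≤ U` of an ordered rational vector space and a positive unit `u ∈ G` such that
`G` and `U` are divisible modulo `u`, `G` is dense and `U / G` is infinite. -/
structure IsDensePair {E : Type*} [AddCommGroup E] [LinearOrder E] [Module ℚ E]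
    (U G : AddSubgroup E) (u : E) : Prop where
  le : G ≤ U
  unit_mem : u ∈ G
  unit_pos : 0 < u
  exists_U : ∀ n : ℕ, 0 < n → ∀ x ∈ U, ∃ y ∈ U, ∃ m : ℤ, x = (n : ℚ) • y + (m : ℚ) • u
  exists_G : ∀ n : ℕ, 0 < n → ∀ x ∈ G, ∃ y ∈ G, ∃ m : ℤ, x = (n : ℚ) • y + (m : ℚ) • u
  dense : ∀ a b : E, a < b → ∃ g ∈ G, a < g ∧ g < b
  index : ∀ F : Finset E, ∃ y ∈ U, ∀ f ∈ F, y - f ∉ G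

/-- Clears the denominators of the coefficients and of their inverses at once: adding `N g` to `x`
then changes `k x` by an integral multiple of `g`, and division by `k` can be absorbed into a factor
`N`. -/
theorem exists_common_multiplier (S : Finset ℚ) : ∃ N : ℕ, 0 < N ∧
    ∀ k ∈ S, (∃ j : ℤ, (N : ℚ) * k = j) ∧ (k ≠ 0 → ∃ j : ℤ, (N : ℚ) = j * k) := by
  induction S using Finset.induction_on with
  | empty => exact ⟨1, one_pos, by simp⟩
  | insert a S _ ih =>
    obtain ⟨N, hN, h⟩ := ih
    by_cases ha : a = 0
    · refine ⟨N, hN, fun k hk => ?_⟩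
      rcases Finset.mem_insert.1 hk with rfl | hk
      · exact ⟨⟨0, by simp [ha]⟩, fun h => absurd ha h⟩
      · exact h k hk
    · have hn : a.num ≠ 0 := Rat.num_ne_zero.2 ha
      obtain ⟨b, hb0, hb⟩ : ∃ b : ℕ, 0 < b ∧ (b : ℚ) = (a.num.sign : ℚ) * a.num := by
        refine ⟨a.num.natAbs, Int.natAbs_pos.2 hn, ?_⟩
        rw [← Int.cast_natCast, ← Int.sign_mul_self_eq_natAbs]
        push_cast
        rfl
      have hda : (a.den : ℚ) * a = a.num := by rw [mul_comm]; exact Rat.mul_den_eq_num a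
      refine ⟨N * (a.den * b), by have := a.den_pos; positivity, fun k hk => ?_⟩
      rcases Finset.mem_insert.1 hk with rfl | hk
      · refine ⟨⟨N * (k.num * b), ?_⟩, fun _ => ⟨N * (k.den * k.den * k.num.sign), ?_⟩⟩
        · push_cast
          linear_combination (N : ℚ) * (b : ℚ) * hda
        · push_cast
          rw [hb, ← hda]; ring
      · obtain ⟨⟨j, hj⟩, h2⟩ := h k hk
        refine ⟨⟨j * (a.den * b), ?_⟩, fun hk0 => ?_⟩
        · push_cast
          linear_combination ((a.den : ℚ) * (b : ℚ)) * hj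
        · obtain ⟨j, hj⟩ := h2 hk0
          refine ⟨j * (a.den * b), ?_⟩
          push_cast
          linear_combination ((a.den : ℚ) * (b : ℚ)) * hj

section

variable {E : Type*} [AddCommGroup E] [Module ℚ E]

theorem AddSubgroup.add_smul_mem_iff (H : AddSubgroup E) {a y : E} (hy : y ∈ H) {c : ℚ} (j : ℤ)
    (hc : c = j) : a + c • y ∈ H ↔ a ∈ H := by
  subst hc
  rw [Int.cast_smul_eq_zsmul]
  exact H.add_mem_cancel_right (H.zsmul_mem hy j)

/-- The multiple of `u` is reduced modulo `n`, so only finitely many residues have to be considered.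
-/
theorem AddSubgroup.exists_eq_smul_add_smul_of_lt (H : AddSubgroup E) {u x : E} (hu : u ∈ H) {n : ℕ}
    (hn : 0 < n) (h : ∃ y ∈ H, ∃ m : ℤ, x = (n : ℚ) • y + (m : ℚ) • u) :
    ∃ y ∈ H, ∃ m < n, x = (n : ℚ) • y + (m : ℚ) • u := by
  obtain ⟨y, hy, m, rfl⟩ := h
  have hn' : (n : ℤ) ≠ 0 := by positivity
  refine ⟨y + ((m / n : ℤ) : ℚ) • u, ?_, (m % n).toNat, ?_, ?_⟩
  · rw [H.add_smul_mem_iff hu _ rfl]; exact hy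
  · have := Int.emod_lt_of_pos m (show (0 : ℤ) < n by positivity)
    have := Int.emod_nonneg m hn'
    omega
  · have h2 : (((m % n).toNat : ℕ) : ℚ) = ((m % n : ℤ) : ℚ) := by
      rw [← Int.cast_natCast, Int.toNat_of_nonneg (Int.emod_nonneg m hn')]
    have h1 : (m : ℚ) = n * ((m / n : ℤ) : ℚ) + ((m % n : ℤ) : ℚ) := by
      exact_mod_cast (Int.mul_ediv_add_emod m n).symm
    rw [h2, smul_add, smul_smul, add_assoc, ← add_smul, ← h1]

variable [LinearOrder E] [IsOrderedAddMonoid E] [IsStrictOrderedModule ℚ E]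

theorem smul_add_pos_iff_of_pos {k : ℚ} (hk : 0 < k) (x l : E) :
    0 < k • x + l ↔ -(k⁻¹ • l) < x := by
  rw [← smul_pos_iff_of_pos_left (inv_pos.2 hk), smul_add, inv_smul_smul₀ hk.ne',
    neg_lt_iff_pos_add]

theorem smul_add_neg_iff_of_pos {k : ℚ} (hk : 0 < k) (x l : E) :
    k • x + l < 0 ↔ x < -(k⁻¹ • l) := by
  rw [← smul_neg_iff_of_pos_left (inv_pos.2 hk), smul_add, inv_smul_smul₀ hk.ne',
    lt_neg_iff_add_neg]

theorem smul_add_pos_iff_of_neg {k : ℚ} (hk : k < 0) (x l : E) :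
    0 < k • x + l ↔ x < -(k⁻¹ • l) := by
  have := smul_add_neg_iff_of_pos (neg_pos.2 hk) x (-l)
  rw [inv_neg, neg_smul_neg, neg_smul, ← neg_add, neg_lt_zero] at this
  exact this

theorem smul_add_neg_iff_of_neg {k : ℚ} (hk : k < 0) (x l : E) :
    k • x + l < 0 ↔ -(k⁻¹ • l) < x := by
  have := smul_add_pos_iff_of_pos (neg_pos.2 hk) x (-l)
  rw [inv_neg, neg_smul_neg, neg_smul, ← neg_add, neg_pos] at this
  exact this

/-- The order relations of a point to finitely many thresholds, among which it has a lower and an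
upper bound, can be transferred to an interval when the thresholds move without changing order. -/
theorem exists_interval_of_thresholds {α β κ : Type*} [LinearOrder α] [LinearOrder β] (I : Finset κ)
    (t : κ → α) (t' : κ → β) (x : α) (hlt : ∀ i ∈ I, ∀ j ∈ I, t i < t j → t' i < t' j)
    (hlow : ∃ i ∈ I, t i < x) (hup : ∃ i ∈ I, x < t i) :
    ∃ a b : β, a < b ∧ ∀ x', a < x' → x' < b → ∀ i ∈ I,
      (t i < x → t' i < x') ∧ (x < t i → x' < t' i) := by
  classical
  obtain ⟨i, hi, hi'⟩ := (I.filter (t · < x)).exists_max_image t' (by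
    obtain ⟨i, hi, h⟩ := hlow
    exact ⟨i, by simp [hi, h]⟩)
  obtain ⟨j, hj, hj'⟩ := (I.filter (x < t ·)).exists_min_image t' (by
    obtain ⟨i, hi, h⟩ := hup
    exact ⟨i, by simp [hi, h]⟩)
  rw [Finset.mem_filter] at hi hj
  refine ⟨t' i, t' j, hlt i hi.1 j hj.1 (hi.2.trans hj.2), fun x' h1 h2 k hk => ⟨fun h => ?_, fun h => ?_⟩⟩
  · exact (hi' k (by simp [hk, h])).trans_lt h1
  · exact h2.trans_le (hj' k (by simp [hk, h]))

namespace IsDensePair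

variable {U G : AddSubgroup E} {u : E}

theorem exists_smul_mem_interval (hE : IsDensePair U G u) {N : ℕ} (hN : 0 < N) (s a b : E)
    (hab : a < b) : ∃ g ∈ G, a < s + (N : ℚ) • g ∧ s + (N : ℚ) • g < b := by
  have hN' : (0 : ℚ) < N := by positivity
  obtain ⟨g, hg, h1, h2⟩ := hE.dense ((N : ℚ)⁻¹ • (a - s)) ((N : ℚ)⁻¹ • (b - s))
    (smul_lt_smul_of_pos_left (sub_lt_sub_right hab s) (inv_pos.2 hN'))
  refine ⟨g, hg, ?_, ?_⟩
  · rw [inv_smul_lt_iff_of_pos hN', sub_lt_iff_lt_add'] at h1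
    exact h1
  · rw [lt_inv_smul_iff_of_pos hN', lt_sub_iff_add_lt'] at h2
    exact h2

omit [IsOrderedAddMonoid E] [IsStrictOrderedModule ℚ E] in
/-- Finitely many cosets of the subgroups `{y | k y ∈ G}`, `k ≠ 0`, do not cover `U`. -/
theorem exists_forall_smul_add_notMem (hE : IsDensePair U G u) (F : Finset (ℚ × E))
    (hF : ∀ p ∈ F, p.1 ≠ 0) :
    ∃ y ∈ U, ∀ p ∈ F, p.1 • y + p.2 ∉ G := by
  classical
  obtain ⟨M, hM, h⟩ := exists_common_multiplier (F.image Prod.fst)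
  -- If `k z + f ∈ G`, then multiplying by the integer `M / k` puts `M z + (M / k) f` in `G`. It
  -- therefore suffices that `M z`, up to a multiple of `u`, avoids finitely many cosets of `G`
  -- itself.
  obtain ⟨y, hy, hyF⟩ := hE.index (F.image fun p => -((M : ℚ) * p.1⁻¹) • p.2)
  obtain ⟨z, hz, m, rfl⟩ := hE.exists_U M hM y hy
  refine ⟨z, hz, fun p hp hmem => ?_⟩
  obtain ⟨j, hj⟩ := (h p.1 (Finset.mem_image_of_mem _ hp)).2 (hF p hp)
  refine hyF _ (Finset.mem_image_of_mem _ hp) ?_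
  have h1 : (M : ℚ) * (p.1)⁻¹ = j := by rw [hj, mul_assoc, mul_inv_cancel₀ (hF p hp), mul_one]
  have h2 : (M : ℚ) • z + (m : ℚ) • u - -((M : ℚ) * p.1⁻¹) • p.2
      = (j : ℚ) • (p.1 • z + p.2) + (m : ℚ) • u := by
    rw [h1, smul_add, smul_smul, ← hj]; module
  rw [h2, G.add_smul_mem_iff hE.unit_mem m rfl, Int.cast_smul_eq_zsmul]
  exact G.zsmul_mem hmem j

end IsDensePair

/-! ### The back-and-forth step -/

section Extension

variable {ι : Type*} [Fintype ι]

/-- Graded back-and-forth: to preserve the types of the forms in `S` when a further element of the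
interval `[0, u)` of `U` is added, it suffices to preserve the types of finitely many forms. -/
theorem exists_extension_forms (S : Finset (ℚ × AffForm ι)) : ∃ S' : Finset (AffForm ι),
    ∀ {E : Type*} [AddCommGroup E] [Module ℚ E] [LinearOrder E] [IsOrderedAddMonoid E]
      [IsStrictOrderedModule ℚ E] {U G : AddSubgroup E} {u : E}, IsDensePair U G u →
      ∀ v v' : ι → E, (∀ l ∈ S', SameType U G (AffForm.eval u v l) (AffForm.eval u v' l)) →
      ∀ x ∈ U, 0 ≤ x → x < u → ∃ x' ∈ U, 0 ≤ x' ∧ x' < u ∧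
        ∀ p ∈ S, SameType U G (p.1 • x + AffForm.eval u v p.2) (p.1 • x' + AffForm.eval u v' p.2) := by
  classical
  -- The two added forms are `x` and `x - u`; preserving their signs keeps the new element in `[0,
  -- u)`.
  set S₁ : Finset (ℚ × AffForm ι) := insert (1, 0) (insert (1, (0, -1)) S) with hS₁
  obtain ⟨N, hN, hNS⟩ := exists_common_multiplier (S₁.image Prod.fst)
  replace hNS : ∀ p ∈ S₁, (∃ j : ℤ, (N : ℚ) * p.1 = j) ∧ (p.1 ≠ 0 → ∃ j : ℤ, (N : ℚ) = j * p.1) :=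
    fun p hp => hNS _ (Finset.mem_image_of_mem _ hp)
  -- `R` lists the values `r` for which `x = r + N y` may be needed. If `k x + f = N² y + m u`, then
  -- `x = -f/k + (m/k) u + N (N/k) y` with `N/k` integral; this is why `m` ranges below `N * N`. The
  -- case `m = 0` gives the threshold `-f/k`. The second family serves decompositions of `x` in `U`.
  set R : Finset (AffForm ι) :=
    (S₁ ×ˢ Finset.range (N * N)).image
      (fun w => -(w.1.1⁻¹ • w.1.2) + ((0, w.1.1⁻¹ * w.2) : AffForm ι)) ∪
    (Finset.range N).image (fun m : ℕ => ((0, (m : ℚ)) : AffForm ι)) with hR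
  refine ⟨R ∪ (S₁ ×ˢ R).image (fun w => w.1.2 + w.1.1 • w.2), ?_⟩
  intro E _ _ _ _ _ U G u hE v v' hvv x hxU hx0 hxu
  set e := AffForm.eval u v with he
  set e' := AffForm.eval u v' with he'
  have hvR : ∀ r ∈ R, SameType U G (e r) (e' r) := fun r hr => hvv r (by simp [hr])
  have hvS : ∀ p ∈ S₁, ∀ r ∈ R, SameType U G (e (p.2 + p.1 • r)) (e' (p.2 + p.1 • r)) :=
    fun p hp r hr => hvv _ (Finset.mem_union_right _
      (Finset.mem_image.2 ⟨(p, r), Finset.mem_product.2 ⟨hp, hr⟩, rfl⟩))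
  have key : ∀ (e : AffForm ι →ₗ[ℚ] E) (p : ℚ × AffForm ι) (r : AffForm ι) (y : E),
      p.1 • (e r + (N : ℚ) • y) + e p.2 = e (p.2 + p.1 • r) + ((N : ℚ) * p.1) • y := by
    intro e p r y; rw [map_add, map_smul]; module
  have memU : ∀ r ∈ R, ∀ y ∈ U, ∀ y' ∈ U, x = e r + (N : ℚ) • y → ∀ p ∈ S₁,
      (p.1 • x + e p.2 ∈ U ↔ p.1 • (e' r + (N : ℚ) • y') + e' p.2 ∈ U) := by
    rintro r hr y hy y' hy' rfl p hp
    obtain ⟨j, hj⟩ := (hNS p hp).1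
    rw [key e, key e', U.add_smul_mem_iff hy j hj, U.add_smul_mem_iff hy' j hj]
    exact (hvS p hp r hr).memU
  have h0S : ((1, 0) : ℚ × AffForm ι) ∈ S₁ := by simp [hS₁]
  have h1S : ((1, (0, -1)) : ℚ × AffForm ι) ∈ S₁ := by simp [hS₁]
  have hS : S ⊆ S₁ := fun p hp => by simp [hS₁, hp]
  have hthr : ∀ p ∈ S₁, -(p.1⁻¹ • p.2) ∈ R := fun p hp => by
    refine Finset.mem_union_left _ (Finset.mem_image.2 ⟨(p, 0), ?_, ?_⟩)
    · simp [hp, hN]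
    · ext <;> simp
  -- it suffices to find `x'` of the same type with respect to the larger set
  suffices ∃ x' ∈ U, ∀ p ∈ S₁, SameType U G (p.1 • x + e p.2) (p.1 • x' + e' p.2) by
    obtain ⟨x', hx', h⟩ := this
    refine ⟨x', hx', ?_, ?_, fun p hp => h p (hS hp)⟩
    · have := (h _ h0S).neg
      simp only [one_smul, map_zero, add_zero] at this
      exact not_lt.1 (mt this.2 hx0.not_gt)
    · have := (h _ h1S).neg
      simp only [one_smul, he, he', AffForm.eval_unit, neg_smul, ← sub_eq_add_neg, sub_neg] at this
      exact this.1 hxu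
  -- If `x` is a zero of one of the forms, it is itself the value of an affine form, and the same
  -- form gives `x'`.
  by_cases hthreshold : ∃ p ∈ S₁, p.1 ≠ 0 ∧ x = e (-(p.1⁻¹ • p.2))
  · obtain ⟨p, hp, hp0, hx⟩ := hthreshold
    refine ⟨e' (-(p.1⁻¹ • p.2)), (hvR _ (hthr p hp)).memU.1 (hx ▸ hxU), fun q hq => ?_⟩
    have := hvS q hq _ (hthr p hp)
    rw [hx, ← map_smul, ← map_smul, ← map_add, ← map_add, add_comm]
    exact this
  push Not at hthreshold
  have hτ : ∀ (e₁ : AffForm ι →ₗ[ℚ] E) (p : ℚ × AffForm ι), e₁ (-(p.1⁻¹ • p.2)) = -(p.1⁻¹ • e₁ p.2) := by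
    intro e₁ p; rw [map_neg, map_smul]
  obtain ⟨a, b, hab, hI⟩ := exists_interval_of_thresholds (S₁.filter (·.1 ≠ 0))
    (fun p => e (-(p.1⁻¹ • p.2))) (fun p => e' (-(p.1⁻¹ • p.2))) x (by
      intro p hp q hq hpq
      rw [Finset.mem_filter] at hp hq
      have := hvS q hq.1 _ (hthr p hp.1)
      rw [add_comm, map_add, map_smul, map_add, map_smul] at this
      rcases lt_or_gt_of_ne hq.2 with h | h
      · rw [hτ e q, ← smul_add_pos_iff_of_neg h, this.pos, smul_add_pos_iff_of_neg h, ← hτ e' q] at hpq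
        exact hpq
      · rw [hτ e q, ← smul_add_neg_iff_of_pos h, this.neg, smul_add_neg_iff_of_pos h, ← hτ e' q] at hpq
        exact hpq)
    ⟨_, Finset.mem_filter.2 ⟨h0S, one_ne_zero⟩, by
      have := hthreshold _ h0S one_ne_zero
      simp at this ⊢
      exact lt_of_le_of_ne hx0 (Ne.symm this)⟩
    ⟨_, Finset.mem_filter.2 ⟨h1S, one_ne_zero⟩, by
      simpa [he] using hxu⟩
  -- the sign conditions hold on the whole interval `(a, b)`
  have hsign : ∀ x', a < x' → x' < b → ∀ p ∈ S₁, (0 < p.1 • x + e p.2 ↔ 0 < p.1 • x' + e' p.2) ∧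
      (p.1 • x + e p.2 < 0 ↔ p.1 • x' + e' p.2 < 0) := by
    intro x' h1 h2 p hp
    by_cases hp0 : p.1 = 0
    · have := hvS p hp _ (hthr p hp)
      simp only [hp0, zero_smul, zero_add, add_zero] at this ⊢
      exact ⟨this.pos, this.neg⟩
    have hI := hI x' h1 h2 p (Finset.mem_filter.2 ⟨hp, hp0⟩)
    simp only [hτ] at hI
    have hne := hthreshold p hp hp0
    rw [hτ] at hne
    have i1 : -(p.1⁻¹ • e p.2) < x ↔ -(p.1⁻¹ • e' p.2) < x' :=
      ⟨hI.1, fun h => (lt_or_gt_of_ne hne).resolve_left fun h' => (hI.2 h').not_gt h⟩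
    have i2 : x < -(p.1⁻¹ • e p.2) ↔ x' < -(p.1⁻¹ • e' p.2) :=
      ⟨hI.2, fun h => (lt_or_gt_of_ne hne).resolve_right fun h' => (hI.1 h').not_gt h⟩
    rcases lt_or_gt_of_ne hp0 with h | h
    · rw [smul_add_pos_iff_of_neg h, smul_add_pos_iff_of_neg h, smul_add_neg_iff_of_neg h,
        smul_add_neg_iff_of_neg h]
      exact ⟨i2, i1⟩
    · rw [smul_add_pos_iff_of_pos h, smul_add_pos_iff_of_pos h, smul_add_neg_iff_of_pos h,
        smul_add_neg_iff_of_pos h]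
      exact ⟨i1, i2⟩
  have hN0 : (N : ℚ) ≠ 0 := by positivity
  -- If some condition `k x + f ∈ G` with `k ≠ 0` holds, then `x ∈ r + N G`, which decides all
  -- memberships; density provides a point of `r + N G` in the interval on which the signs are
  -- right.
  by_cases hcoset : ∃ p ∈ S₁, p.1 ≠ 0 ∧ p.1 • x + e p.2 ∈ G
  · obtain ⟨p, hp, hp0, hg⟩ := hcoset
    obtain ⟨y, hy, m, hm, hym⟩ := G.exists_eq_smul_add_smul_of_lt hE.unit_mem
      (Nat.mul_pos hN hN) (hE.exists_G _ (Nat.mul_pos hN hN) _ hg)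
    obtain ⟨j, hj⟩ := (hNS p hp).2 hp0
    set r : AffForm ι := -(p.1⁻¹ • p.2) + (0, p.1⁻¹ * m) with hr
    have hrR : r ∈ R := Finset.mem_union_left _ (Finset.mem_image.2 ⟨(p, m), by simp [hp, hm], rfl⟩)
    have hz : (j : ℚ) • y ∈ G := by rw [Int.cast_smul_eq_zsmul]; exact G.zsmul_mem hy j
    have hx : x = e r + (N : ℚ) • (j : ℚ) • y := by
      have h1 : p.1⁻¹ * (N * N) = N * j := by rw [hj]; field_simp
      rw [hr, map_add, hτ, AffForm.eval_unit, smul_smul, ← h1]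
      apply smul_right_injective E hp0
      simp only [smul_add, smul_neg, smul_smul, ← mul_assoc, mul_inv_cancel₀ hp0, one_smul, one_mul]
      rw [← sub_eq_zero]
      have := sub_eq_zero.2 hym
      rw [← this]; push_cast; module
    obtain ⟨g, hgG, h1, h2⟩ := hE.exists_smul_mem_interval hN (e' r) a b hab
    refine ⟨e' r + (N : ℚ) • g, ?_, fun q hq => ⟨(hsign _ h1 h2 q hq).1, (hsign _ h1 h2 q hq).2,
      memU r hrR _ (hE.le hz) _ (hE.le hgG) hx q hq, ?_⟩⟩
    · rw [U.add_smul_mem_iff (hE.le hgG) (c := (N : ℚ)) N (by simp), ← (hvR r hrR).memU,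
        ← U.add_smul_mem_iff (hE.le hz) (c := (N : ℚ)) N (by simp), ← hx]
      exact hxU
    · obtain ⟨i, hi⟩ := (hNS q hq).1
      rw [hx, key e, key e', G.add_smul_mem_iff hz i hi, G.add_smul_mem_iff hgG i hi]
      exact (hvS q hq r hrR).memG
  · push Not at hcoset
    obtain ⟨y, hy, m, hm, hym⟩ := U.exists_eq_smul_add_smul_of_lt (hE.le hE.unit_mem) hN
      (hE.exists_U _ hN _ hxU)
    set r : AffForm ι := (0, (m : ℚ)) with hr
    have hrR : r ∈ R := Finset.mem_union_right _ (Finset.mem_image.2 ⟨m, by simp [hm], rfl⟩)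
    have hx : x = e r + (N : ℚ) • y := by rw [hr, he, AffForm.eval_unit, add_comm]; exact hym
    -- When no such condition holds for `x`, infinite index gives a point violating all of them;
    -- moving it into the interval by an element of `N G` does not affect this.
    obtain ⟨y₀, hy₀, hav⟩ := hE.exists_forall_smul_add_notMem
      ((S₁.filter (·.1 ≠ 0)).image fun p => ((N : ℚ) * p.1, e' (p.2 + p.1 • r)))
      (by
        intro q hq
        obtain ⟨p, hp, rfl⟩ := Finset.mem_image.1 hq
        exact mul_ne_zero hN0 (Finset.mem_filter.1 hp).2)
    obtain ⟨g, hgG, h1, h2⟩ := hE.exists_smul_mem_interval hN (e' r + (N : ℚ) • y₀) a b hab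
    rw [add_assoc, ← smul_add] at h1 h2
    have hy' : y₀ + g ∈ U := U.add_mem hy₀ (hE.le hgG)
    refine ⟨e' r + (N : ℚ) • (y₀ + g), ?_, fun q hq => ⟨(hsign _ h1 h2 q hq).1,
      (hsign _ h1 h2 q hq).2, memU r hrR _ hy _ hy' hx q hq, ?_⟩⟩
    · rw [U.add_smul_mem_iff hy' (c := (N : ℚ)) N (by simp), ← (hvR r hrR).memU,
        ← U.add_smul_mem_iff hy (c := (N : ℚ)) N (by simp), ← hx]
      exact hxU
    · by_cases hq0 : q.1 = 0
      · have := (hvS q hq _ (hthr q hq)).memG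
        simpa only [hq0, zero_smul, zero_add, add_zero] using this
      refine iff_of_false (hcoset q hq hq0) ?_
      obtain ⟨i, hi⟩ := (hNS q hq).1
      rw [key e', smul_add, ← add_assoc, G.add_smul_mem_iff hgG i hi, add_comm]
      exact hav _ (Finset.mem_image.2 ⟨q, Finset.mem_filter.2 ⟨hq, hq0⟩, rfl⟩)

end Extension

end

/-! ### The universal cover of an oriented abelian group -/

/-- Oriented abelian groups. -/
structure IsOriented {A : Type*} [AddCommGroup A] (O : A → A → A → Prop) : Prop where
  cyc : ∀ {a b c}, O a b c → O b c a
  add_right : ∀ {a b c}, O a b c → ∀ d, O (a + d) (b + d) (c + d)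
  ne : ∀ {x y}, O 0 x y → x ≠ 0 ∧ y ≠ 0 ∧ x ≠ y
  trans : ∀ {x y z}, O 0 x y → O 0 y z → O 0 x z
  total : ∀ {x y}, x ≠ 0 → y ≠ 0 → x ≠ y → O 0 x y ∨ O 0 y x

namespace IsOriented

variable {A : Type*} [AddCommGroup A] {O : A → A → A → Prop} (h : IsOriented O)

include h

theorem add_right_iff {a b c : A} (d : A) : O (a + d) (b + d) (c + d) ↔ O a b c :=
  ⟨fun H => by simpa using h.add_right H (-d), fun H => h.add_right H d⟩

theorem sub_iff {a b c : A} : O 0 (b - a) (c - a) ↔ O a b c := by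
  simpa using h.add_right_iff (a := 0) (b := b - a) (c := c - a) a |>.symm

theorem not_swap {a b c : A} (H : O a b c) : ¬ O a c b := fun H' =>
  (h.ne (h.trans (h.sub_iff.2 H) (h.sub_iff.2 H'))).2.2 rfl

omit h in
open Classical in
/-- The linear order with least element `0` induced by an orientation. -/
noncomputable abbrev linearOrder (h : IsOriented O) : LinearOrder A where
  le a b := a = b ∨ b ≠ 0 ∧ (a = 0 ∨ O 0 a b)
  le_refl a := Or.inl rfl
  le_trans a b c := by
    rintro (rfl | ⟨hb, hab⟩) (rfl | ⟨hc, hbc⟩)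
    · exact Or.inl rfl
    · exact Or.inr ⟨hc, hbc⟩
    · exact Or.inr ⟨hb, hab⟩
    · refine Or.inr ⟨hc, hab.imp_right fun hab => ?_⟩
      exact h.trans hab (hbc.resolve_left hb)
  le_antisymm a b := by
    rintro (rfl | ⟨hb, hab⟩) (h' | ⟨ha, hba⟩)
    · rfl
    · rfl
    · exact h'.symm
    · exact absurd (hba.resolve_left hb) (h.not_swap (hab.resolve_left ha))
  le_total a b := by
    by_cases hab : a = b
    · exact Or.inl (Or.inl hab)
    by_cases ha : a = 0
    · exact Or.inl (Or.inr ⟨fun hb => hab (ha.trans hb.symm), Or.inl ha⟩)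
    by_cases hb : b = 0
    · exact Or.inr (Or.inr ⟨ha, Or.inl hb⟩)
    exact (h.total ha hb hab).imp (fun H => Or.inr ⟨hb, Or.inr H⟩) fun H => Or.inr ⟨ha, Or.inr H⟩
  toDecidableLE := Classical.decRel _

theorem lt_iff {a b : A} : h.linearOrder.lt a b ↔ b ≠ 0 ∧ (a = 0 ∨ O 0 a b) := by
  let _ := h.linearOrder
  change a < b ↔ _
  rw [lt_iff_le_and_ne]
  constructor
  · rintro ⟨rfl | h1, h2⟩
    · exact absurd rfl h2
    · exact h1
  · intro H
    refine ⟨Or.inr H, ?_⟩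
    rintro rfl
    exact H.2.elim H.1 fun H' => (h.ne H').2.2 rfl

theorem orient_of_lt_of_lt {a b c : A} (hab : h.linearOrder.lt a b) (hbc : h.linearOrder.lt b c) :
    O a b c := by
  rw [h.lt_iff] at hab hbc
  have hb := hbc.2.resolve_left hab.1
  rcases hab.2 with rfl | ha
  · exact hb
  have h1 : O b c 0 := h.cyc hb
  have h2 : O b 0 a := h.cyc (h.cyc ha)
  have h3 : O b c a := h.sub_iff.1 (h.trans (h.sub_iff.2 h1) (h.sub_iff.2 h2))
  exact h.cyc (h.cyc h3)

theorem orient_iff {a b c : A} : O a b c ↔ h.linearOrder.lt a b ∧ h.linearOrder.lt b c ∨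
    h.linearOrder.lt b c ∧ h.linearOrder.lt c a ∨ h.linearOrder.lt c a ∧ h.linearOrder.lt a b := by
  let _ := h.linearOrder
  change _ ↔ a < b ∧ b < c ∨ b < c ∧ c < a ∨ c < a ∧ a < b
  have key : ∀ {a b c : A}, a < b → b < c → O a b c := h.orient_of_lt_of_lt
  constructor
  · intro H
    have hne := h.ne (h.sub_iff.2 H)
    have h1 : b ≠ a := sub_ne_zero.1 hne.1
    have h2 : c ≠ a := sub_ne_zero.1 hne.2.1
    have h3 : b ≠ c := fun e => hne.2.2 (by rw [e])
    have hn := h.not_swap H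
    by_contra hcon
    apply hn
    rcases lt_or_gt_of_ne h1 with h1 | h1 <;> rcases lt_or_gt_of_ne h2 with h2 | h2 <;>
      rcases lt_or_gt_of_ne h3 with h3 | h3
    · exact absurd (Or.inr (Or.inl ⟨h3, h2⟩)) hcon
    · exact h.cyc (h.cyc (key h3 h1))
    · exact h.cyc (key h1 h2)
    · exact h.cyc (key h1 h2)
    · exact absurd (Or.inr (Or.inr ⟨h2, h1⟩)) hcon
    · exact absurd (Or.inr (Or.inr ⟨h2, h1⟩)) hcon
    · exact absurd (Or.inl ⟨h1, h3⟩) hcon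
    · exact key h2 h3
  · rintro (⟨h1, h2⟩ | ⟨h1, h2⟩ | ⟨h1, h2⟩)
    · exact key h1 h2
    · exact h.cyc (h.cyc (key h1 h2))
    · exact h.cyc (key h1 h2)

omit h in
open Classical in
/-- `1` if `b < a` and `0` otherwise: the number of times one passes `0` on the way from `a` to `b`
in positive direction. -/
noncomputable def passes (h : IsOriented O) (a b : A) : ℤ := if h.linearOrder.lt b a then 1 else 0

/-- `passes` depends on the place where the circle is cut, at `0`. Its coboundary does not: it is
expressed by the orientation and equality alone, and so is translation invariant. -/
theorem passes_defect (p q r : A) [Decidable (O r q p ∨ p = r ∧ p ≠ q)] :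
    h.passes p q + h.passes q r - h.passes p r = if O r q p ∨ p = r ∧ p ≠ q then 1 else 0 := by
  let _ := h.linearOrder
  rw [if_congr (or_congr_left h.orient_iff) rfl rfl]
  change (if q < p then 1 else 0) + (if r < q then 1 else 0) - (if r < p then 1 else 0) =
    if (r < q ∧ q < p ∨ q < p ∧ p < r ∨ p < r ∧ r < q) ∨ p = r ∧ p ≠ q then (1 : ℤ) else 0
  rcases lt_trichotomy p q with h1 | h1 | h1 <;> rcases lt_trichotomy q r with h2 | h2 | h2 <;>
    rcases lt_trichotomy p r with h3 | h3 | h3 <;> grind -linarith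

theorem passes_defect_add (p q r t : A) :
    h.passes (p + t) (q + t) + h.passes (q + t) (r + t) - h.passes (p + t) (r + t) =
      h.passes p q + h.passes q r - h.passes p r := by
  classical
  rw [h.passes_defect, h.passes_defect]
  simp [h.add_right_iff]

/-- The carry of an addition. -/
noncomputable def carry (h : IsOriented O) (a b : A) : ℤ := h.passes a (a + b)

theorem carry_eq [∀ a b, Decidable (h.linearOrder.lt a b)] (a b : A) :
    h.carry a b = if h.linearOrder.lt (a + b) a then 1 else 0 := by
  unfold carry passes
  congr

theorem not_lt_zero (a : A) : ¬ h.linearOrder.lt a 0 := by simp [h.lt_iff]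

theorem carry_zero_left (a : A) : h.carry 0 a = 0 := by
  classical
  rw [h.carry_eq, if_neg (h.not_lt_zero _)]

/-- The cocycle identity is the translation invariance of the coboundary of `passes`, for the triple
`0, b, b + c` shifted by `a`. -/
theorem carry_assoc (a b c : A) :
    h.carry a b + h.carry (a + b) c = h.carry b c + h.carry a (b + c) := by
  have h1 := h.passes_defect_add 0 b (b + c) a
  have h2 : h.passes 0 b = 0 := by rw [← h.carry_zero_left b, carry, zero_add]
  have h3 : h.passes 0 (b + c) = 0 := by rw [← h.carry_zero_left (b + c), carry, zero_add]
  rw [h2, h3] at h1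
  have h4 : b + c + a = a + b + c := by abel
  rw [h4, zero_add, add_comm b a] at h1
  simp only [carry]
  rw [← add_assoc a b c]
  linarith

/-- Wrapping past `0` is symmetric in the summands, which makes the carry commutative. Otherwise
translations of the two inequalities would close up to the impossible chain `c < a + c < a < -c < -a
- c < -a < c`. -/
theorem add_lt_left {a c : A} (H : h.linearOrder.lt (a + c) a) : h.linearOrder.lt (a + c) c := by
  let _ := h.linearOrder
  have hlt : ∀ {x y : A}, x < y → x ≠ 0 → O 0 x y := fun h1 h2 =>
    (h.lt_iff.1 h1).2.resolve_left h2
  have hlt' : ∀ {x y : A}, O 0 x y → x < y := fun h1 => h.lt_iff.2 ⟨(h.ne h1).2.1, Or.inr h1⟩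
  change a + c < a at H
  change a + c < c
  have ha : a ≠ 0 := by rintro rfl; exact h.not_lt_zero _ H
  by_cases hc : c = 0
  · subst hc; simp at H
  by_cases hac : a + c = 0
  · rw [hac]; exact h.lt_iff.2 ⟨hc, Or.inl rfl⟩
  by_contra hcon
  have h1 : c < a + c := lt_of_le_of_ne (not_lt.1 hcon) (by simpa using ha)
  have e1 : ∀ {x y z : A} (t : A) {x' y' z' : A}, O x y z → x + t = x' → y + t = y' → z + t = z' →
      O x' y' z' := by
    rintro x y z t _ _ _ H rfl rfl rfl; exact h.add_right H t
  have h2 : O 0 (a + c) a := hlt H hac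
  have h3 : O 0 c (a + c) := hlt h1 hc
  -- `-a < c` and `-c ≥ a`
  have h4 : O 0 (-a) c := h.cyc (h.cyc (e1 (-a) h2 (zero_add _) (by abel) (by abel)))
  have h5 : O 0 a (-c) := h.cyc (e1 (-c) h3 (zero_add _) (by abel) (by abel))
  have h6 : O 0 (-c) (-a + -c) := h.cyc (h.cyc (e1 (-c) h4 (zero_add _) rfl (by abel)))
  have h7 : O 0 (-a + -c) (-a) := h.cyc (e1 (-a) h5 (zero_add _) (by abel) (by abel))
  exact lt_irrefl _ (h1.trans (H.trans ((hlt' h5).trans ((hlt' h6).trans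
    ((hlt' h7).trans (hlt' h4))))))

theorem carry_comm (a b : A) : h.carry a b = h.carry b a := by
  classical
  rw [h.carry_eq, h.carry_eq, add_comm b a]
  refine if_congr ⟨fun H => h.add_lt_left H, fun H => ?_⟩ rfl rfl
  rw [add_comm] at H ⊢
  exact h.add_lt_left H

end IsOriented

/-- The universal cover of an oriented abelian group: the elements are those of the group together
with a winding number. -/
@[ext]
structure OrientedCover {A : Type*} [AddCommGroup A] {O : A → A → A → Prop} (h : IsOriented O) where
  wind : ℤ
  elt : A

namespace OrientedCover

variable {A : Type*} [AddCommGroup A] {O : A → A → A → Prop} {h : IsOriented O}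

instance : Zero (OrientedCover h) := ⟨⟨0, 0⟩⟩
noncomputable instance : Add (OrientedCover h) :=
  ⟨fun x y => ⟨x.wind + y.wind + h.carry x.elt y.elt, x.elt + y.elt⟩⟩
noncomputable instance : Neg (OrientedCover h) :=
  ⟨fun x => ⟨-x.wind - h.carry (-x.elt) x.elt, -x.elt⟩⟩

@[simp] theorem zero_wind : (0 : OrientedCover h).wind = 0 := rfl
@[simp] theorem zero_elt : (0 : OrientedCover h).elt = 0 := rfl
theorem add_wind (x y : OrientedCover h) :
    (x + y).wind = x.wind + y.wind + h.carry x.elt y.elt := rfl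
@[simp] theorem add_elt (x y : OrientedCover h) : (x + y).elt = x.elt + y.elt := rfl

noncomputable instance : AddCommGroup (OrientedCover h) where
  add_assoc x y z := by
    ext
    · simp only [add_wind, add_elt]
      linarith [h.carry_assoc x.elt y.elt z.elt]
    · exact add_assoc _ _ _
  zero_add x := by
    ext
    · simp [add_wind, h.carry_zero_left]
    · exact zero_add _
  add_zero x := by
    ext
    · simp [add_wind, h.carry_comm _ 0, h.carry_zero_left]
    · exact add_zero _
  nsmul := nsmulRec
  zsmul := zsmulRec
  neg_add_cancel x := by
    ext
    · rw [add_wind]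
      change -x.wind - h.carry (-x.elt) x.elt + x.wind + h.carry (-x.elt) x.elt = 0
      ring
    · exact neg_add_cancel _
  add_comm x y := by
    ext
    · simp only [add_wind, h.carry_comm x.elt]
      ring
    · exact add_comm _ _

noncomputable instance : LinearOrder (OrientedCover h) :=
  let _ := h.linearOrder
  LinearOrder.lift' (fun x => toLex (x.wind, x.elt)) fun x y H => by
    have := toLex.injective H
    ext
    · exact congrArg Prod.fst this
    · exact congrArg Prod.snd this

theorem lt_iff {x y : OrientedCover h} :
    x < y ↔ x.wind < y.wind ∨ x.wind = y.wind ∧ h.linearOrder.lt x.elt y.elt := by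
  let _ := h.linearOrder
  exact Prod.Lex.toLex_lt_toLex

theorem add_lt_add_of_lt {x y : OrientedCover h} (H : x < y) (z : OrientedCover h) :
    x + z < y + z := by
  classical
  let _ := h.linearOrder
  rw [lt_iff] at H ⊢
  simp only [add_wind, add_elt]
  rcases H with H | ⟨H, H'⟩
  · have h1 : x.elt + z.elt < x.elt ↔ x.elt + z.elt < z.elt :=
      ⟨fun H => h.add_lt_left H, fun H => by rw [add_comm] at H ⊢; exact h.add_lt_left H⟩
    have h2 : y.elt + z.elt < z.elt → y.elt + z.elt < y.elt :=
      fun H => by rw [add_comm] at H ⊢; exact h.add_lt_left H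
    rw [h.carry_eq, h.carry_eq]
    split_ifs with i j j
    · left; omega
    -- Only the first sum carries, so the winding numbers may become equal; the elements are then
    -- compared through `x + z < z ≤ y + z`.
    · by_cases hw : x.wind + 1 < y.wind
      · left; omega
      · right
        exact ⟨by omega, (h1.1 i).trans_le (not_lt.1 fun H => j (h2 H))⟩
    · left; omega
    · left; omega
  -- With equal winding numbers, the difference of the two carries is exactly `passes (x + z) (y +
  -- z)`.
  · have h1 := h.passes_defect_add 0 x.elt y.elt z.elt
    have h2 : h.passes 0 x.elt = 0 := if_neg (h.not_lt_zero _)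
    have h3 : h.passes 0 y.elt = 0 := if_neg (h.not_lt_zero _)
    have h4 : h.passes x.elt y.elt = 0 := if_neg (lt_asymm H')
    have h5 : h.carry z.elt x.elt = h.passes (0 + z.elt) (x.elt + z.elt) := by
      rw [IsOriented.carry, zero_add, add_comm x.elt]
    have h6 : h.carry z.elt y.elt = h.passes (0 + z.elt) (y.elt + z.elt) := by
      rw [IsOriented.carry, zero_add, add_comm y.elt]
    rw [h2, h3, h4, ← h5, ← h6] at h1
    rw [h.carry_comm x.elt, h.carry_comm y.elt]
    rcases lt_or_gt_of_ne (fun e => H'.ne (add_right_cancel e) : x.elt + z.elt ≠ y.elt + z.elt)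
      with i | i
    · have : h.passes (x.elt + z.elt) (y.elt + z.elt) = 0 := if_neg (lt_asymm i)
      exact Or.inr ⟨by omega, i⟩
    · have : h.passes (x.elt + z.elt) (y.elt + z.elt) = 1 := if_pos i
      left; omega

instance : IsOrderedAddMonoid (OrientedCover h) where
  add_le_add_left x y H z := by
    rcases H.lt_or_eq with H | rfl
    · exact (add_lt_add_of_lt H z).le
    · exact le_rfl

/-- The lift of an element to a fundamental domain. -/
def lift (h : IsOriented O) (a : A) : OrientedCover h := ⟨0, a⟩

/-- The unit of the universal cover. -/
def unit (h : IsOriented O) : OrientedCover h := ⟨1, 0⟩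

/-- The projection of the universal cover. -/
def proj (h : IsOriented O) : OrientedCover h →+ A where
  toFun := elt
  map_zero' := rfl
  map_add' _ _ := rfl

@[simp] theorem lift_elt (a : A) : (lift h a).elt = a := rfl
@[simp] theorem lift_wind (a : A) : (lift h a).wind = 0 := rfl
@[simp] theorem unit_elt : (unit h).elt = 0 := rfl
@[simp] theorem unit_wind : (unit h).wind = 1 := rfl
@[simp] theorem sub_elt (x y : OrientedCover h) : (x - y).elt = x.elt - y.elt :=
  map_sub (proj h) x y
@[simp] theorem zsmul_elt (n : ℤ) (x : OrientedCover h) : (n • x).elt = n • x.elt :=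
  map_zsmul (proj h) n x
@[simp] theorem nsmul_elt (n : ℕ) (x : OrientedCover h) : (n • x).elt = n • x.elt :=
  map_nsmul (proj h) n x

@[simp] theorem lift_zero : lift h 0 = 0 := rfl

theorem add_unit_wind (x : OrientedCover h) : (x + unit h).wind = x.wind + 1 := by
  simp [add_wind, h.carry_comm _ 0, h.carry_zero_left]

theorem zsmul_unit_wind (n : ℤ) : (n • unit h).wind = n := by
  induction n using Int.induction_on with
  | zero => simp
  | succ n ih => rw [add_smul, one_smul, add_unit_wind, ih]
  | pred n ih =>
    have := add_unit_wind ((-(n : ℤ) - 1) • unit h)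
    rw [← add_one_zsmul, sub_add_cancel, ih] at this
    omega

theorem eq_lift_add (x : OrientedCover h) : x = lift h x.elt + x.wind • unit h := by
  ext
  · simp [add_wind, h.carry_comm _ 0, h.carry_zero_left, zsmul_unit_wind]
  · simp

theorem exists_eq_add_of_elt_eq {x y : OrientedCover h} (H : x.elt = y.elt) :
    ∃ n : ℤ, x = y + n • unit h := by
  refine ⟨x.wind - y.wind, ?_⟩
  rw [eq_lift_add x, eq_lift_add y, H]
  simp [sub_smul]
  abel_nf
  simp [zsmul_unit_wind, add_wind, h.carry_comm _ 0, h.carry_zero_left]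

theorem unit_pos : 0 < unit h := by simp [lt_iff]

theorem lift_nonneg (a : A) : 0 ≤ lift h a := by
  rw [← not_lt, lt_iff]
  simpa using h.not_lt_zero a

theorem lift_lt_unit (a : A) : lift h a < unit h := by simp [lt_iff]

theorem lift_injective : Function.Injective (lift h) := fun _ _ H => congrArg elt H

theorem lift_lt_lift {a b : A} : lift h a < lift h b ↔ h.linearOrder.lt a b := by simp [lt_iff]

theorem lift_pos {a : A} (ha : a ≠ 0) : 0 < lift h a :=
  lt_of_le_of_ne (lift_nonneg a) fun e => ha (lift_injective e).symm

theorem pos_iff (x : OrientedCover h) : 0 < x ↔ 1 ≤ x.wind ∨ 0 ≤ x.wind ∧ x.elt ≠ 0 := by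
  rw [lt_iff, h.lt_iff]
  simp only [zero_wind, zero_elt, true_or, and_true]
  by_cases hx : x.elt = 0
  · simp only [hx, ne_eq, not_true_eq_false, and_false, or_false]
    omega
  · simp only [hx, ne_eq, not_false_eq_true, and_true]
    omega

theorem eq_lift {x : OrientedCover h} (h0 : 0 ≤ x) (h1 : x < unit h) : x = lift h x.elt := by
  rw [← not_lt, lt_iff] at h0
  rw [lt_iff] at h1
  have h2 := h.not_lt_zero x.elt
  simp only [zero_wind, zero_elt, unit_wind, unit_elt] at h0 h1
  ext
  · simp only [lift_wind]
    simp only [h2, and_false, or_false] at h0 h1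
    omega
  · rfl

theorem lift_add (a b : A) : lift h (a + b) = lift h a + lift h b ∧ lift h a + lift h b < unit h ∨
    lift h (a + b) = lift h a + lift h b - unit h ∧ unit h ≤ lift h a + lift h b := by
  rcases lt_or_ge (lift h a + lift h b) (unit h) with H | H
  · refine Or.inl ⟨(eq_lift (add_nonneg (lift_nonneg _) (lift_nonneg _)) H).symm, H⟩
  · refine Or.inr ⟨?_, H⟩
    have := eq_lift (sub_nonneg.2 H) (by
      rw [sub_lt_iff_lt_add]
      exact add_lt_add (lift_lt_unit a) (lift_lt_unit b))
    rw [this]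
    simp

theorem lift_neg (a : A) : a = 0 ∨ lift h (-a) = unit h - lift h a := by
  by_cases ha : a = 0
  · exact Or.inl ha
  right
  have := eq_lift (x := unit h - lift h a) (sub_nonneg.2 (lift_lt_unit a).le)
    (sub_lt_self _ (lift_pos ha))
  rw [this]
  simp

theorem orient_iff {a b c : A} : O a b c ↔ lift h a < lift h b ∧ lift h b < lift h c ∨
    lift h b < lift h c ∧ lift h c < lift h a ∨ lift h c < lift h a ∧ lift h a < lift h b := by
  simp only [lift_lt_lift]
  exact h.orient_iff

theorem orient_zero_iff {a b : A} : O 0 a b ↔ 0 < lift h a ∧ lift h a < lift h b := by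
  rw [orient_iff (h := h), lift_zero]
  have h1 := (lift_nonneg (h := h) a).not_gt
  have h2 := (lift_nonneg (h := h) b).not_gt
  tauto

end OrientedCover

/-! ### Density and divisibility in the universal cover -/

/-- A regularly dense divisible oriented abelian group with a dense divisible subgroup of infinite
index. -/
structure IsDenseOrientedPair {A : Type*} [AddCommGroup A] (O : A → A → A → Prop)
    (G : AddSubgroup A) : Prop extends IsOriented O where
  regular : ∀ p : ℕ, p.Prime → ∀ a b, O 0 a b → ∃ c, O a (p • c) b ∧
    ∀ i, 1 ≤ i → i ≤ p - 1 → O 0 (i • c) ((i + 1) • c)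
  divisible : ∀ p : ℕ, p.Prime → ∀ a : A, ∃ b, a = p • b
  divisible_subgroup : ∀ p : ℕ, p.Prime → ∀ a ∈ G, ∃ b ∈ G, a = p • b
  dense : ∀ a b, (∃ x, O a x b) → ∃ x ∈ G, O a x b
  index : ∀ m : ℕ, ∃ x : Fin m → A, ∀ i j, i ≠ j → x i - x j ∉ G

theorem AddSubgroup.exists_nsmul_of_prime {A : Type*} [AddCommGroup A] (G : AddSubgroup A)
    (hG : ∀ p : ℕ, p.Prime → ∀ a ∈ G, ∃ b ∈ G, a = p • b) (n : ℕ) (hn : 0 < n) :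
    ∀ a ∈ G, ∃ b ∈ G, a = n • b := by
  induction n using Nat.recOnMul with
  | zero => exact absurd hn (lt_irrefl _)
  | one => exact fun a ha => ⟨a, ha, (one_smul _ _).symm⟩
  | prime p hp => exact hG p hp
  | mul m n hm hn' =>
    intro a ha
    obtain ⟨b, hb, rfl⟩ := hm (Nat.pos_of_mul_pos_right hn) a ha
    obtain ⟨c, hc, rfl⟩ := hn' (Nat.pos_of_mul_pos_left hn) b hb
    exact ⟨c, hc, by rw [mul_smul]⟩

namespace IsDenseOrientedPair

open OrientedCover

variable {A : Type*} [AddCommGroup A] {O : A → A → A → Prop} {G : AddSubgroup A}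
  (hG : IsDenseOrientedPair O G)

include hG

/-- The universal cover. -/
abbrev Cover (hG : IsDenseOrientedPair O G) := OrientedCover hG.toIsOriented

/-- The conditions `i c <₀ (i + 1) c` in regular density say that the multiples of `c` up to `p c`
never pass `0`; hence lifting to the cover commutes with these multiples. -/
theorem exists_prime_nsmul_between {p : ℕ} (hp : p.Prime) {x y : hG.Cover} (h0 : 0 < x) (hxy : x < y)
    (hy : y < unit _) : ∃ c : hG.Cover, x < p • c ∧ p • c < y := by
  have hx' := eq_lift h0.le (hxy.trans hy)
  have hy' := eq_lift (h0.trans hxy).le hy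
  obtain ⟨c, hc, hi⟩ := hG.regular p hp x.elt y.elt
    ((orient_zero_iff (h := hG.toIsOriented)).2 ⟨hx' ▸ h0, by rwa [← hx', ← hy']⟩)
  have key : ∀ i, 1 ≤ i → i ≤ p → i • lift hG.toIsOriented c = lift hG.toIsOriented (i • c) := by
    intro i hi1
    induction i, hi1 using Nat.le_induction with
    | base => intro; simp
    | succ i hi1 ih =>
      intro hip
      have h1 := (orient_zero_iff (h := hG.toIsOriented)).1 (hi i hi1 (by omega))
      rw [succ_nsmul, ih (by omega), succ_nsmul]
      rcases lift_add (h := hG.toIsOriented) (i • c) c with h2 | h2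
      · exact h2.1.symm
      · refine absurd h1.2 (not_lt.2 ?_)
        rw [succ_nsmul, h2.1, sub_le_iff_le_add]
        gcongr
        exact (lift_lt_unit c).le
  refine ⟨lift _ c, ?_⟩
  rw [key p hp.one_le le_rfl]
  rw [orient_iff (h := hG.toIsOriented), ← hx', ← hy'] at hc
  rcases hc with hc | hc | hc
  · exact hc
  · exact absurd hc.2 hxy.not_gt
  · exact absurd hc.1 hxy.not_gt

/-- A least positive `x` is excluded by comparing `2 x` with the unit `u`. If `2 x < u`, some `2 e`
lies between `x` and `2 x`, and `2 e - x` is smaller. If `2 x = u`, a further nonzero element `d`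
gives `d - x < x`. If `2 x > u`, take `u - x`. Infinite index enters only to provide three distinct
elements. -/
theorem exists_pos_lt {x : hG.Cover} (hx : 0 < x) : ∃ y : hG.Cover, 0 < y ∧ y < x := by
  obtain ⟨t, ht⟩ := hG.index 3
  have hinj : Function.Injective t := fun i j hij => by
    by_contra hne
    exact ht i j hne (by rw [hij, sub_self]; exact G.zero_mem)
  have third : ∀ b : A, ∃ c, c ≠ 0 ∧ c ≠ b := by
    classical
    intro b
    by_contra! hcon
    have : Finset.univ.image t ⊆ {0, b} := fun c _ => by
      by_cases hc : c = 0
      · simp [hc]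
      · simp [hcon c hc]
    have := Finset.card_le_card this
    rw [Finset.card_image_of_injective _ hinj, Finset.card_fin] at this
    have := this.trans Finset.card_le_two
    omega
  by_contra! hcon
  have hlift : ∀ c : A, c ≠ 0 → x ≤ lift hG.toIsOriented c := fun c hc => hcon _ (lift_pos hc)
  obtain ⟨c, hc0, -⟩ := third 0
  have hxu : x < unit _ := (hlift c hc0).trans_lt (lift_lt_unit _)
  rcases lt_trichotomy (x + x) (unit _) with h1 | h1 | h1
  · obtain ⟨e, h2, h3⟩ := hG.exists_prime_nsmul_between Nat.prime_two hx (lt_add_of_pos_left x hx) h1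
    exact (hcon (2 • e - x) (sub_pos.2 h2)).not_gt (by rwa [sub_lt_iff_lt_add])
  · obtain ⟨d, hd0, hd⟩ := third x.elt
    have h2 : x < lift hG.toIsOriented d := by
      refine lt_of_le_of_ne (hlift d hd0) fun e => hd ?_
      rw [e]; rfl
    exact (hcon _ (sub_pos.2 h2)).not_gt (by
      rw [sub_lt_iff_lt_add, h1]; exact lift_lt_unit d)
  · exact (hcon _ (sub_pos.2 hxu)).not_gt (by rwa [sub_lt_iff_lt_add])

/-- Induction over the factorization: between two multiples `m c₁ < m c₂` found in the interval, a
multiple of the other factor is inserted between `c₁` and `c₂`. -/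
theorem exists_nsmul_between {n : ℕ} (hn : 0 < n) : ∀ {x y : hG.Cover}, 0 < x → x < y →
    y < unit _ → ∃ c : hG.Cover, x < n • c ∧ n • c < y := by
  induction n using Nat.recOnMul with
  | zero => exact absurd hn (lt_irrefl _)
  | one =>
    intro x y h0 hxy hy
    obtain ⟨c, hc⟩ := hG.exists_prime_nsmul_between Nat.prime_two h0 hxy hy
    exact ⟨2 • c, by simpa using hc⟩
  | prime p hp => exact hG.exists_prime_nsmul_between hp
  | mul m n hm hn' =>
    intro x y h0 hxy hy
    have hm0 := Nat.pos_of_mul_pos_right hn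
    obtain ⟨c₁, h1, h2⟩ := hm hm0 h0 hxy hy
    obtain ⟨c₂, h3, h4⟩ := hm hm0 (h0.trans h1) h2 hy
    obtain ⟨d, h5, h6⟩ := hn' (Nat.pos_of_mul_pos_left hn) (x := c₁) (y := c₂)
      ((nsmul_pos_iff hm0.ne').1 (h0.trans h1)) (lt_of_nsmul_lt_nsmul_right m h3) (by
        by_contra hcon
        have hc : unit _ ≤ c₂ := not_lt.1 hcon
        have h7 := nsmul_le_nsmul_left (unit_pos.le.trans hc) hm0
        rw [Nat.succ_eq_add_one, zero_add, one_smul] at h7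
        exact ((hc.trans h7).trans_lt h4).not_gt hy)
    refine ⟨d, ?_, ?_⟩
    · rw [mul_smul]
      exact h1.trans (nsmul_right_strictMono hm0.ne' h5)
    · rw [mul_smul]
      exact (nsmul_right_strictMono hm0.ne' h6).trans h4

/-- Passes from the interval `(0, u)` to the whole cover: the points approximable from above by
multiples of `n` are closed under addition and under translation by multiples of `n`. -/
theorem exists_nsmul_gt_lt {n : ℕ} (hn : 0 < n) (x ε : hG.Cover) (hε : 0 < ε) :
    ∃ c : hG.Cover, x < n • c ∧ n • c < x + ε := by
  let Q : hG.Cover → Prop := fun x => ∀ ε, 0 < ε → ∃ c : hG.Cover, x < n • c ∧ n • c < x + ε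
  suffices hQ : ∀ x, Q x from hQ x ε hε
  have hadd : ∀ x y, Q x → Q y → Q (x + y) := by
    intro x y hx hy ε hε
    obtain ⟨δ, h1, h2⟩ := hG.exists_pos_lt hε
    obtain ⟨c, h3, h4⟩ := hx δ h1
    obtain ⟨d, h5, h6⟩ := hy (ε - δ) (sub_pos.2 h2)
    refine ⟨c + d, ?_, ?_⟩
    · rw [smul_add]; exact add_lt_add h3 h5
    · rw [smul_add]
      refine (add_lt_add h4 h6).trans_eq ?_
      abel
  have htrans : ∀ x z, Q x → Q (x + n • z) := by
    intro x z hx ε hε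
    obtain ⟨c, h3, h4⟩ := hx ε hε
    refine ⟨c + z, ?_, ?_⟩
    · rw [smul_add]; exact add_lt_add_left h3 _
    · rw [smul_add, add_right_comm]; exact add_lt_add_left h4 _
  have hlift : ∀ x, 0 < x → x < unit _ → Q x := by
    intro x h0 h1 ε hε
    obtain ⟨δ, h2, h3⟩ := hG.exists_pos_lt (lt_min hε (sub_pos.2 h1))
    obtain ⟨c, h4, h5⟩ := hG.exists_nsmul_between hn h0 (lt_add_of_pos_right x h2)
      (lt_sub_iff_add_lt'.1 (h3.trans_le (min_le_right _ _)))
    exact ⟨c, h4, h5.trans (add_lt_add_right (h3.trans_le (min_le_left _ _)) _)⟩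
  have hzero : Q 0 := by
    intro ε hε
    obtain ⟨δ, h2, h3⟩ := hG.exists_pos_lt (lt_min hε unit_pos)
    obtain ⟨δ', h4, h5⟩ := hG.exists_pos_lt h2
    obtain ⟨c, h6, h7⟩ := hG.exists_nsmul_between hn h4 h5 (h3.trans_le (min_le_right _ _))
    exact ⟨c, h4.trans h6, by rw [zero_add]; exact h7.trans (h3.trans_le (min_le_left _ _))⟩
  have hunit : Q (unit _) := by
    obtain ⟨δ, h2, h3⟩ := hG.exists_pos_lt (unit_pos (h := hG.toIsOriented))
    have := hadd _ _ (hlift δ h2 h3) (hlift (unit _ - δ) (sub_pos.2 h3) (sub_lt_self _ h2))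
    rwa [add_sub_cancel] at this
  have hnat : ∀ m : ℕ, Q (m • unit _) := by
    intro m
    induction m with
    | zero => simpa using hzero
    | succ m ih => rw [succ_nsmul]; exact hadd _ _ ih hunit
  intro x
  have h1 : Q (lift _ x.elt) := by
    rcases (lift_nonneg (h := hG.toIsOriented) x.elt).eq_or_lt with h | h
    · rw [← h]; exact hzero
    · exact hlift _ h (lift_lt_unit _)
  -- Adding `n * |wind|` makes the number of units nonnegative, so that `hnat` applies; the excess
  -- is a multiple of `n` and is translated away.
  have h2 := htrans _ (-(x.wind.natAbs : ℤ) • unit _)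
    (hadd _ _ h1 (hnat (x.wind + n * x.wind.natAbs).toNat))
  convert h2 using 1
  have h3 : ((x.wind + n * x.wind.natAbs).toNat : ℤ) = x.wind + n * x.wind.natAbs := by
    apply Int.toNat_of_nonneg
    have h4 : (1 : ℤ) * x.wind.natAbs ≤ n * x.wind.natAbs := by gcongr; exact_mod_cast hn
    omega
  conv_lhs => rw [eq_lift_add x]
  rw [add_assoc, ← natCast_zsmul (unit _), h3, ← natCast_zsmul _ n, smul_smul, ← add_smul]
  congr 2
  ring

/-- The interval is first shortened to length `ε` less than the unit, so that it corresponds to an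
orientation interval in the group; the smaller `δ` shows the latter to be nonempty. -/
theorem exists_mem_between {x y : hG.Cover} (hxy : x < y) :
    ∃ g : hG.Cover, g.elt ∈ G ∧ x < g ∧ g < y := by
  obtain ⟨ε, h1, h2⟩ := hG.exists_pos_lt (lt_min (sub_pos.2 hxy) unit_pos)
  obtain ⟨δ, h3, h4⟩ := hG.exists_pos_lt h1
  have hδ := eq_lift h3.le (h4.trans (h2.trans_le (min_le_right _ _)))
  have hε := eq_lift h1.le (h2.trans_le (min_le_right _ _))
  obtain ⟨g, hg, hO⟩ := hG.dense x.elt (x.elt + ε.elt) ⟨x.elt + δ.elt, by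
    rw [← hG.sub_iff, orient_zero_iff (h := hG.toIsOriented), add_sub_cancel_left,
      add_sub_cancel_left, ← hδ, ← hε]
    exact ⟨h3, h4⟩⟩
  rw [← hG.sub_iff, orient_zero_iff (h := hG.toIsOriented), add_sub_cancel_left, ← hε] at hO
  refine ⟨x + lift _ (g - x.elt), by simpa using hg, lt_add_of_pos_right _ hO.1, ?_⟩
  have := hO.2.trans (h2.trans_le (min_le_left _ _))
  rwa [lt_sub_iff_add_lt'] at this

omit hG in
/-- The elements of the universal cover inside its divisible hull. -/
noncomputable def coverSubgroup (hG : IsDenseOrientedPair O G) :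
    AddSubgroup (DivisibleHull hG.Cover) :=
  (DivisibleHull.coeAddMonoidHom hG.Cover).range

omit hG in
/-- The preimage of the subgroup in the universal cover, inside the divisible hull. -/
noncomputable def liftSubgroup (hG : IsDenseOrientedPair O G) :
    AddSubgroup (DivisibleHull hG.Cover) :=
  (G.comap (proj _)).map (DivisibleHull.coeAddMonoidHom hG.Cover)

theorem coe_mem_liftSubgroup {x : hG.Cover} :
    (x : DivisibleHull hG.Cover) ∈ hG.liftSubgroup ↔ x.elt ∈ G := by
  constructor
  · rintro ⟨y, hy, hxy⟩
    rwa [← DivisibleHull.coe_injective hxy]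
  · exact fun hx => ⟨x, hx, rfl⟩

theorem coe_mem_coverSubgroup (x : hG.Cover) :
    (x : DivisibleHull hG.Cover) ∈ hG.coverSubgroup := ⟨x, rfl⟩

theorem coe_add_smul_unit (y : hG.Cover) (n : ℕ) (m : ℤ) :
    ((n • y + m • unit _ : hG.Cover) : DivisibleHull hG.Cover) =
      (n : ℚ) • (y : DivisibleHull hG.Cover) + (m : ℚ) • (unit _ : hG.Cover) := by
  rw [Nat.cast_smul_eq_nsmul, Int.cast_smul_eq_zsmul, DivisibleHull.coe_add, DivisibleHull.nsmul_mk,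
    DivisibleHull.zsmul_mk]

theorem isDensePair : IsDensePair hG.coverSubgroup hG.liftSubgroup
    ((unit _ : hG.Cover) : DivisibleHull hG.Cover) where
  le := by
    rintro _ ⟨y, _, rfl⟩
    exact ⟨y, rfl⟩
  unit_mem := hG.coe_mem_liftSubgroup.2 G.zero_mem
  unit_pos := by
    rw [← DivisibleHull.mk_zero 1, DivisibleHull.mk_lt_mk]
    simpa using unit_pos
  exists_U n hn x hx := by
    obtain ⟨x, rfl⟩ := hx
    obtain ⟨b, -, hb⟩ := (⊤ : AddSubgroup A).exists_nsmul_of_prime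
      (fun p hp a _ => (hG.divisible p hp a).imp fun b hb => ⟨trivial, hb⟩) n hn x.elt trivial
    obtain ⟨m, hm⟩ := exists_eq_add_of_elt_eq (x := x) (y := n • lift _ b) (by simpa using hb)
    exact ⟨_, hG.coe_mem_coverSubgroup (lift _ b), m, by rw [← hG.coe_add_smul_unit, ← hm]; rfl⟩
  exists_G n hn x hx := by
    obtain ⟨x, hx, rfl⟩ := hx
    obtain ⟨b, hbG, hb⟩ := G.exists_nsmul_of_prime hG.divisible_subgroup n hn x.elt hx
    obtain ⟨m, hm⟩ := exists_eq_add_of_elt_eq (x := x) (y := n • lift _ b) (by simpa using hb)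
    exact ⟨_, (hG.coe_mem_liftSubgroup (x := lift _ b)).2 hbG, m,
      by rw [← hG.coe_add_smul_unit, ← hm]; rfl⟩
  dense a b hab := by
    induction a with | mk x s
    induction b with | mk y t
    rw [DivisibleHull.mk_lt_mk] at hab
    -- For the bounds `x / s < y / t`, two multiples `s t c₁ < s t c₂` are placed between `t x` and
    -- `s y`; an element of the subgroup between `c₁` and `c₂` then lies between the two fractions.
    obtain ⟨c₁, h1, h2⟩ := hG.exists_nsmul_gt_lt (s * t).pos _ _ (sub_pos.2 hab)
    rw [add_sub_cancel] at h2
    obtain ⟨c₂, h3, h4⟩ := hG.exists_nsmul_gt_lt (s * t).pos _ _ (sub_pos.2 h2)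
    rw [add_sub_cancel] at h4
    obtain ⟨g, hg, h5, h6⟩ := hG.exists_mem_between (lt_of_nsmul_lt_nsmul_right _ h3)
    have h7 := h1.trans (nsmul_right_strictMono (s * t).pos.ne' h5)
    have h8 := (nsmul_right_strictMono (s * t).pos.ne' h6).trans h4
    rw [PNat.mul_coe] at h8
    refine ⟨g, hG.coe_mem_liftSubgroup.2 hg, ?_, ?_⟩
    · rw [DivisibleHull.mk_lt_mk]
      dsimp only at h7
      rw [PNat.mul_coe, mul_comm, mul_smul] at h7
      simpa using lt_of_nsmul_lt_nsmul_right _ h7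
    · rw [DivisibleHull.mk_lt_mk]
      dsimp only at h8
      rw [mul_smul] at h8
      simpa using lt_of_nsmul_lt_nsmul_right _ h8
  index F := by
    classical
    obtain ⟨x, hx⟩ := hG.index (F.card + 1)
    by_contra! hcon
    choose f hfF hf using fun i => hcon _ (hG.coe_mem_coverSubgroup (lift _ (x i)))
    -- By pigeonhole, two of `F.card + 1` elements in distinct cosets would lie in the coset of the
    -- same element of `F`.
    obtain ⟨i, j, hij, hfij⟩ := Fintype.exists_ne_map_eq_of_card_lt
      (fun i => (⟨f i, hfF i⟩ : F)) (by simp)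
    have := sub_mem (hf i) (hf j)
    rw [Subtype.mk.inj hfij, sub_sub_sub_cancel_right] at this
    refine hx i j hij ?_
    have h2 : ((lift _ (x i) : hG.Cover) : DivisibleHull hG.Cover) - (lift _ (x j) : hG.Cover) =
        ((lift _ (x i) - lift _ (x j) : hG.Cover) : DivisibleHull hG.Cover) :=
      (map_sub (DivisibleHull.coeAddMonoidHom hG.Cover) _ _).symm
    rw [h2, hG.coe_mem_liftSubgroup] at this
    simpa using this

end IsDenseOrientedPair

/-! ### Reading the axioms of oriented groups in a model -/

namespace OrientedGroup

section Semantics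

variable {M : Type*} [LO.Structure M] {α : Type*}

theorem realize_zero' (v : α → M) :
    (0 : LO.Term α).realize v = Structure.funMap (L := LO) OFunc.zero ![] := by
  change Structure.funMap (L := LO) OFunc.zero _ = _
  congr 1
  exact Subsingleton.elim _ _

theorem realize_neg' (v : α → M) (t : LO.Term α) :
    (-t).realize v = Structure.funMap (L := LO) OFunc.neg ![t.realize v] :=
  Term.realize_functions_apply₁

theorem realize_add' (v : α → M) (s t : LO.Term α) :
    (s + t).realize v = Structure.funMap (L := LO) OFunc.add ![s.realize v, t.realize v] :=
  Term.realize_functions_apply₂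

/-- The orientation of an `LO`-structure. -/
def Orient (a b c : M) : Prop := Structure.RelMap (L := LO) ORel.orient ![a, b, c]

@[simp]
theorem realize_orient {n : ℕ} (v : α → M) (xs : Fin n → M) (r s t : LO.Term (α ⊕ Fin n)) :
    (orient r s t).Realize v xs ↔ Orient (r.realize (Sum.elim v xs)) (s.realize (Sum.elim v xs))
      (t.realize (Sum.elim v xs)) := by
  unfold orient Orient
  rw [BoundedFormula.realize_rel]
  apply iff_of_eq
  congr 1
  ext i
  fin_cases i <;> rfl

variable (M) in
/-- The function symbols of an `LO`-structure are interpreted by the operations of an abelian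
group. -/
structure IsGroupStructure [AddCommGroup M] : Prop where
  zero : Structure.funMap (L := LO) OFunc.zero ![] = (0 : M)
  neg : ∀ a : M, Structure.funMap (L := LO) OFunc.neg ![a] = -a
  add : ∀ a b : M, Structure.funMap (L := LO) OFunc.add ![a, b] = a + b

namespace IsGroupStructure

variable [AddCommGroup M] (hM : IsGroupStructure M) (v : α → M)

include hM

theorem realize_zero : (0 : LO.Term α).realize v = 0 := by
  rw [realize_zero', hM.zero]

theorem realize_neg (t : LO.Term α) : (-t).realize v = -t.realize v := by
  rw [realize_neg', hM.neg]

theorem realize_add (s t : LO.Term α) : (s + t).realize v = s.realize v + t.realize v := by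
  rw [realize_add', hM.add]

theorem realize_mulTerm (k : ℕ) (t : LO.Term α) : (mulTerm k t).realize v = k • t.realize v := by
  induction k with
  | zero => simp [mulTerm, hM.realize_zero]
  | succ k ih => simp [mulTerm, hM.realize_add, ih, succ_nsmul]

end IsGroupStructure

theorem exists_isGroupStructure (h : M ⊨ orientedAxioms) :
    ∃ _ : AddCommGroup M, IsGroupStructure M ∧ IsOriented (Orient (M := M)) := by
  simp only [orientedAxioms, Theory.model_insert_iff, Theory.model_singleton_iff] at h
  simp only [Sentence.Realize, Formula.Realize, BoundedFormula.realize_all,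
    BoundedFormula.realize_bdEqual, realize_add', realize_neg', realize_zero', realize_orient,
    BoundedFormula.realize_imp, BoundedFormula.realize_inf, BoundedFormula.realize_sup,
    BoundedFormula.realize_not, Term.realize_var, Sum.elim_inr, Function.comp_apply] at h
  obtain ⟨hassoc, hcomm, hzero, hneg, hcyc, hadd, hne, htrans, htotal⟩ := h
  let grp : AddCommGroup M :=
    { add := fun a b => Structure.funMap (L := LO) OFunc.add ![a, b]
      neg := fun a => Structure.funMap (L := LO) OFunc.neg ![a]
      zero := Structure.funMap (L := LO) OFunc.zero ![]
      add_assoc := hassoc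
      zero_add := hzero
      add_zero := fun a => (hcomm a _).trans (hzero a)
      neg_add_cancel := hneg
      add_comm := hcomm
      nsmul := @nsmulRec M ⟨Structure.funMap (L := LO) OFunc.zero ![]⟩
        ⟨fun a b => Structure.funMap (L := LO) OFunc.add ![a, b]⟩
      zsmul := @zsmulRec M ⟨Structure.funMap (L := LO) OFunc.zero ![]⟩
        ⟨fun a b => Structure.funMap (L := LO) OFunc.add ![a, b]⟩
        ⟨fun a => Structure.funMap (L := LO) OFunc.neg ![a]⟩
        (@nsmulRec M ⟨Structure.funMap (L := LO) OFunc.zero ![]⟩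
        ⟨fun a b => Structure.funMap (L := LO) OFunc.add ![a, b]⟩) }
  refine ⟨grp, ⟨rfl, fun _ => rfl, fun _ _ => rfl⟩, ?_⟩
  exact
    { cyc := fun {a b c} => hcyc a b c
      add_right := fun {a b c} H d => hadd a b c d H
      ne := fun {x y} H => ⟨(hne x y H).1.1, (hne x y H).1.2, (hne x y H).2⟩
      trans := fun {x y z} => htrans x y z
      total := fun {x y} => htotal x y }

theorem realize_regularlyDenseAt [AddCommGroup M] (hM : IsGroupStructure M) {p : ℕ}
    (h : M ⊨ regularlyDenseAt p) (a b : M) (hab : Orient 0 a b) :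
    ∃ c : M, Orient a (p • c) b ∧ ∀ i, 1 ≤ i → i ≤ p - 1 → Orient 0 (i • c) ((i + 1) • c) := by
  simp only [regularlyDenseAt, Sentence.Realize, Formula.Realize, BoundedFormula.realize_all,
    realize_orient, BoundedFormula.realize_imp, BoundedFormula.realize_inf,
    BoundedFormula.realize_ex, BoundedFormula.realize_iInf, hM.realize_mulTerm,
    hM.realize_zero, Term.realize_var, Sum.elim_inr, Function.comp_apply] at h
  obtain ⟨c, hc, hi⟩ := h a b hab
  exact ⟨c, hc, fun i h1 h2 => hi ⟨i, Finset.mem_Icc.2 ⟨h1, h2⟩⟩⟩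

theorem exists_eq_nsmul_of_quotient [AddCommGroup M] (hM : IsGroupStructure M) {p : ℕ}
    (h : ¬ M ⊨ quotientAtLeast p 2) (a : M) : ∃ b : M, a = p • b := by
  by_contra hcon
  apply h
  simp only [quotientAtLeast, Sentence.Realize, BoundedFormula.realize_exs,
    BoundedFormula.realize_iInf, BoundedFormula.realize_not, BoundedFormula.realize_ex,
    BoundedFormula.realize_bdEqual, hM.realize_mulTerm, hM.realize_add, hM.realize_neg,
    Term.realize_var, Sum.elim_inr, Function.comp_apply, Fin.snoc_castSucc, Fin.snoc_last]
  refine ⟨![a, 0], ?_⟩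
  rintro ⟨⟨i, j⟩, hij⟩ ⟨b, hb⟩
  dsimp only at hij hb
  fin_cases i <;> fin_cases j
  · exact hij rfl
  · exact hcon ⟨b, by simpa using hb⟩
  · exact hcon ⟨-b, by simpa [neg_eq_iff_eq_neg] using hb⟩
  · exact hij rfl

/-- For `d = 0` the quotient by `p` has `p ^ 0 = 1` element, so the theory denies that it has two.
-/
theorem exists_eq_nsmul [AddCommGroup M] (hM : IsGroupStructure M) {e : Nat.Primes → ℕ∞}
    (h : M ⊨ groupTheory 0 e) (p : ℕ) (hp : p.Prime) (a : M) : ∃ b : M, a = p • b := by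
  refine exists_eq_nsmul_of_quotient hM ?_ a
  rw [← Sentence.realize_not]
  refine Theory.realize_sentence_of_mem (groupTheory 0 e) (Or.inl (Or.inr ⟨⟨p, hp⟩, 2, ?_⟩))
  rw [if_neg]
  change ¬ ((2 : ℕ) : ℕ∞) ≤ ((p : ℕ) : ℕ∞) ^ (0 : ℕ∞)
  rw [ENat.epow_zero]
  simp

end Semantics

/-! ### Models of the theory of pairs -/

section Pairs

variable {M : Type*} [LOP.Structure M]

/-- The underlying `LO`-structure of an `LOP`-structure. -/
instance reductStructure : LO.Structure M :=
  (LHom.sumInl : LO →ᴸ LOP).reduct M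

instance : (LHom.sumInl : LO →ᴸ LOP).IsExpansionOn M := LHom.isExpansionOn_reduct (LHom.sumInl : LO →ᴸ LOP) M

/-- The predicate of an `LOP`-structure. -/
def InV (a : M) : Prop := Structure.RelMap symbV ![a]

variable {α : Type*} {n : ℕ} (v : α → M) (xs : Fin n → M)

@[simp]
theorem realize_lift (φ : LO.BoundedFormula α n) : (lift φ).Realize v xs ↔ φ.Realize v xs :=
  LHom.realize_onBoundedFormula _ _

@[simp]
theorem realize_inV (t : LO.Term (α ⊕ Fin n)) :
    (inV t).Realize v xs ↔ InV (t.realize (Sum.elim v xs)) := by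
  simp only [inV, BoundedFormula.realize_rel₁, LHom.realize_onTerm]
  rfl

/-- Makes the substructure on `V` a model of its own group theory, so that divisibility of the
subgroup follows from the result for models. -/
theorem realize_restrictV (S : LO.Substructure M) (hS : ∀ x, x ∈ S ↔ InV x)
    (φ : LO.BoundedFormula α n) (v : α → S) (xs : Fin n → S) :
    (restrictV φ).Realize (fun i => (v i : M)) (fun i => (xs i : M)) ↔ φ.Realize v xs := by
  have hterm : ∀ {n : ℕ} (xs : Fin n → S) (t : LO.Term (α ⊕ Fin n)),
      t.realize (Sum.elim (fun i => (v i : M)) fun i => (xs i : M)) =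
        (t.realize (Sum.elim v xs) : S) := by
    intro n xs t
    have := HomClass.realize_term S.subtype (t := t) (v := Sum.elim v xs)
    rw [Substructure.subtype_apply] at this
    rw [← this]
    congr 1
    ext (i | i) <;> rfl
  induction φ with
  | falsum => rfl
  | equal s t =>
    rw [restrictV, realize_lift]
    change s.realize _ = t.realize _ ↔ s.realize _ = t.realize _
    rw [hterm, hterm, Subtype.coe_inj]
  | rel R ts =>
    rw [restrictV, realize_lift]
    simp only [BoundedFormula.Realize, hterm]
    exact Iff.rfl
  | imp φ ψ ih1 ih2 =>
    rw [restrictV, BoundedFormula.realize_imp, BoundedFormula.realize_imp]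
    exact imp_congr (ih1 xs) (ih2 xs)
  | all φ ih =>
    rw [restrictV, BoundedFormula.realize_all, BoundedFormula.realize_all]
    simp only [BoundedFormula.realize_imp, realize_inV, Term.realize_var, Sum.elim_inr,
      Function.comp_apply, Fin.snoc_last]
    have key : ∀ a : S, (Fin.snoc (fun i => (xs i : M)) (a : M) : Fin (_ + 1) → M) =
        fun i => ((Fin.snoc xs a : Fin (_ + 1) → S) i : M) := by
      intro a
      ext i
      refine Fin.lastCases ?_ (fun i => ?_) i <;> simp
    constructor
    · intro H a
      have := H a ((hS _).1 a.2)
      rw [key] at this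
      exact (ih _).1 this
    · intro H a ha
      have := H ⟨a, (hS a).2 ha⟩
      have := (ih _).2 this
      rwa [← key] at this

variable (M) in
/-- An `LOP`-structure is a dense pair of oriented abelian groups. -/
structure IsPairStructure [AddCommGroup M] (G : AddSubgroup M) : Prop extends
    IsGroupStructure M where
  mem_iff : ∀ a : M, a ∈ G ↔ InV a
  isDense : IsDenseOrientedPair (Orient (M := M)) G

theorem exists_isPairStructure {e₁ e₂ : Nat.Primes → ℕ∞} (h : M ⊨ pairTheory 0 e₁ 0 e₂) :
    ∃ (_ : AddCommGroup M) (G : AddSubgroup M), IsPairStructure M G := by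
  simp only [pairTheory, Theory.model_union_iff, LHom.onTheory_model] at h
  obtain ⟨⟨⟨hA, hV⟩, hG⟩, hind⟩ := h
  obtain ⟨grp, hgrp, hor⟩ := exists_isGroupStructure (M := M)
    (hA.mono fun φ hφ => Or.inl (Or.inl (Or.inl hφ)))
  simp only [denseSubgroupAxioms, Theory.model_insert_iff, Theory.model_singleton_iff] at hV
  simp only [Sentence.Realize, Formula.Realize, BoundedFormula.realize_all,
    BoundedFormula.realize_imp, BoundedFormula.realize_inf, BoundedFormula.realize_ex,
    realize_inV, realize_lift, realize_orient, hgrp.realize_zero, hgrp.realize_neg,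
    hgrp.realize_add, Term.realize_var, Sum.elim_inr, Function.comp_apply] at hV
  obtain ⟨hzero, hneg, hadd, hdense⟩ := hV
  let G : AddSubgroup M :=
    { carrier := {x | InV x}
      zero_mem' := hzero
      add_mem' := fun {a b} => hadd a b
      neg_mem' := fun {a} => hneg a }
  let S : LO.Substructure M :=
    { carrier := {x | InV x}
      fun_mem := by
        intro n f x hx
        cases f with
        | zero =>
          rw [Subsingleton.elim x ![], hgrp.zero]
          exact hzero
        | neg =>
          have : x = ![x 0] := by ext i; fin_cases i; rfl
          rw [this, hgrp.neg]
          exact hneg _ (hx 0)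
        | add =>
          have : x = ![x 0, x 1] := by ext i; fin_cases i <;> rfl
          rw [this, hgrp.add]
          exact hadd _ _ (hx 0) (hx 1) }
  let grpS : AddCommGroup S := inferInstanceAs (AddCommGroup G)
  have hgrpS : IsGroupStructure S := by
    refine ⟨?_, fun a => ?_, fun a b => ?_⟩
    · refine Subtype.ext (Eq.trans ?_ hgrp.zero)
      change Structure.funMap (L := LO) (M := M) _ _ = Structure.funMap (L := LO) (M := M) _ _
      congr 1
      exact Subsingleton.elim _ _
    · refine Subtype.ext (Eq.trans ?_ (hgrp.neg a))
      change Structure.funMap (L := LO) (M := M) _ _ = Structure.funMap (L := LO) (M := M) _ _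
      congr 1
      ext i; fin_cases i; rfl
    · refine Subtype.ext (Eq.trans ?_ (hgrp.add a b))
      change Structure.funMap (L := LO) (M := M) _ _ = Structure.funMap (L := LO) (M := M) _ _
      congr 1
      ext i; fin_cases i <;> rfl
  have hSmod : S ⊨ groupTheory 0 e₂ := by
    rw [Theory.model_iff]
    intro φ hφ
    have := hG.realize_of_mem _ ⟨φ, hφ, rfl⟩
    refine (realize_restrictV S (fun _ => Iff.rfl) φ default default).1 ?_
    have e := congrArg₂ (restrictV φ).Realize
      (Subsingleton.elim (default : Empty → M) fun i => ((default : Empty → S) i : M))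
      (Subsingleton.elim (default : Fin 0 → M) fun i => ((default : Fin 0 → S) i : M))
    exact e.mp this
  refine ⟨grp, G, { hgrp with mem_iff := fun _ => Iff.rfl, isDense := { hor with
    regular := ?_, divisible := ?_, divisible_subgroup := ?_, dense := ?_, index := ?_ } }⟩
  · intro p hp
    exact realize_regularlyDenseAt hgrp (hA.realize_of_mem _ (Or.inl (Or.inl (Or.inr ⟨⟨p, hp⟩, rfl⟩))))
  · exact exists_eq_nsmul hgrp hA
  · intro p hp a ha
    obtain ⟨b, hb⟩ := exists_eq_nsmul hgrpS hSmod p hp ⟨a, ha⟩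
    refine ⟨b, b.2, (congrArg Subtype.val hb).trans ?_⟩
    exact map_nsmul G.subtype p b
  · intro a b ⟨x, hx⟩
    exact hdense a b ⟨x, hx⟩
  · intro m
    have := hind.realize_of_mem _ ⟨m, rfl⟩
    simp only [indexAtLeast, Sentence.Realize, BoundedFormula.realize_exs,
      BoundedFormula.realize_iInf, BoundedFormula.realize_not, realize_inV, hgrp.realize_add,
      hgrp.realize_neg, Term.realize_var, Sum.elim_inr, Function.comp_apply] at this
    obtain ⟨x, hx⟩ := this
    exact ⟨x, fun i j hij => by rw [sub_eq_add_neg]; exact hx ⟨(i, j), hij⟩⟩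

end Pairs

end OrientedGroup

theorem SameType.symm {E : Type*} [AddCommGroup E] [LinearOrder E] {U G : AddSubgroup E} {a b : E}
    (h : SameType U G a b) : SameType U G b a :=
  ⟨h.pos.symm, h.neg.symm, h.memU.symm, h.memG.symm⟩

theorem SameType.refl {E : Type*} [AddCommGroup E] [LinearOrder E] (U G : AddSubgroup E) (a : E) :
    SameType U G a a :=
  ⟨Iff.rfl, Iff.rfl, Iff.rfl, Iff.rfl⟩

/-! ### Coordinates of a pair in the divisible hull of its cover -/

namespace OrientedGroup

namespace IsPairStructure

open OrientedCover hiding lift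

variable {M : Type*} [LOP.Structure M] [AddCommGroup M] {G : AddSubgroup M}
  (hM : IsPairStructure M G)

/-- The divisible hull of the universal cover. -/
abbrev Hull := DivisibleHull hM.isDense.Cover

/-- The lift of an element to a fundamental domain in the divisible hull of the universal cover. -/
noncomputable def toHull (a : M) : hM.Hull := ((OrientedCover.lift _ a : hM.isDense.Cover) : hM.Hull)

/-- The unit of the universal cover in its divisible hull. -/
noncomputable def hullUnit : hM.Hull := ((unit _ : hM.isDense.Cover) : hM.Hull)

theorem isDensePair :
    IsDensePair hM.isDense.coverSubgroup hM.isDense.liftSubgroup hM.hullUnit :=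
  hM.isDense.isDensePair

theorem coe_lt_coe {x y : hM.isDense.Cover} : (x : hM.Hull) < (y : hM.Hull) ↔ x < y := by
  rw [DivisibleHull.mk_lt_mk]
  simp

theorem coe_sub (x y : hM.isDense.Cover) :
    ((x - y : hM.isDense.Cover) : hM.Hull) = (x : hM.Hull) - (y : hM.Hull) :=
  map_sub (DivisibleHull.coeAddMonoidHom hM.isDense.Cover) x y

theorem toHull_injective : Function.Injective hM.toHull :=
  DivisibleHull.coe_injective.comp lift_injective

theorem toHull_zero : hM.toHull 0 = 0 := by
  simp [toHull]

theorem toHull_mem (a : M) : hM.toHull a ∈ hM.isDense.coverSubgroup := ⟨_, rfl⟩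

theorem toHull_mem_iff (a : M) : hM.toHull a ∈ hM.isDense.liftSubgroup ↔ InV a :=
  hM.isDense.coe_mem_liftSubgroup.trans (hM.mem_iff a)

theorem toHull_nonneg (a : M) : 0 ≤ hM.toHull a := by
  rw [← DivisibleHull.mk_zero 1, ← not_lt]
  exact fun h => (lift_nonneg (h := hM.isDense.toIsOriented) a).not_gt (hM.coe_lt_coe.1 h)

theorem toHull_lt_unit (a : M) : hM.toHull a < hM.hullUnit :=
  hM.coe_lt_coe.2 (lift_lt_unit a)

theorem exists_toHull_eq {x : hM.Hull} (hx : x ∈ hM.isDense.coverSubgroup) (h0 : 0 ≤ x)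
    (h1 : x < hM.hullUnit) : ∃ a, hM.toHull a = x := by
  obtain ⟨y, rfl⟩ := hx
  refine ⟨y.elt, ?_⟩
  rw [toHull, ← eq_lift (x := y) ?_ (hM.coe_lt_coe.1 h1)]
  · rfl
  · rw [← not_lt]
    intro h
    exact h0.not_gt ((hM.coe_lt_coe.2 h).trans_eq (DivisibleHull.mk_zero 1))

theorem orient_iff {a b c : M} : Orient a b c ↔ hM.toHull a < hM.toHull b ∧ hM.toHull b < hM.toHull c ∨
    hM.toHull b < hM.toHull c ∧ hM.toHull c < hM.toHull a ∨
    hM.toHull c < hM.toHull a ∧ hM.toHull a < hM.toHull b := by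
  simp only [toHull, hM.coe_lt_coe]
  exact OrientedCover.orient_iff (h := hM.isDense.toIsOriented)

/-- Each alternative carries the sign of an affine form, so that tuples agreeing on that form fall
into the same case; `toHull_neg` is stated in the same way, with `0` as its exceptional case. -/
theorem toHull_add (a b : M) :
    hM.toHull (a + b) = hM.toHull a + hM.toHull b ∧ hM.toHull a + hM.toHull b - hM.hullUnit < 0 ∨
    hM.toHull (a + b) = hM.toHull a + hM.toHull b - hM.hullUnit ∧
      ¬ hM.toHull a + hM.toHull b - hM.hullUnit < 0 := by
  rw [sub_neg, toHull, toHull, toHull, hullUnit, ← DivisibleHull.coe_add, hM.coe_lt_coe, not_lt,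
    ← hM.coe_sub, DivisibleHull.coe_inj, DivisibleHull.coe_inj]
  exact lift_add a b

theorem toHull_neg (a : M) : hM.toHull (-a) = hM.toHull a ∧ ¬ 0 < hM.toHull a ∨
    hM.toHull (-a) = hM.hullUnit - hM.toHull a ∧ 0 < hM.toHull a := by
  rcases lift_neg (h := hM.isDense.toIsOriented) a with rfl | h
  · left
    simp [toHull_zero]
  by_cases ha : a = 0
  · left
    simp [ha, toHull_zero]
  · right
    refine ⟨?_, lt_of_le_of_ne (hM.toHull_nonneg a) fun e => ha ?_⟩
    · rw [toHull, h, hM.coe_sub]; rfl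
    · rw [← hM.toHull_zero] at e
      exact (hM.toHull_injective e).symm

variable {α : Type*} [Fintype α]

/-- The value of an affine form at a tuple of elements. -/
noncomputable def val (v : α → M) : AffForm α →ₗ[ℚ] hM.Hull :=
  AffForm.eval hM.hullUnit fun i => hM.toHull (v i)

@[simp]
theorem val_unit (v : α → M) (q : ℚ) : hM.val v ((0, q) : AffForm α) = q • hM.hullUnit :=
  AffForm.eval_unit _ _ _

/-- The affine form `vᵢ`. -/
def _root_.AffForm.var [DecidableEq α] (i : α) : AffForm α := (Pi.single i 1, 0)

@[simp]
theorem val_var [DecidableEq α] (v : α → M) (i : α) : hM.val v (AffForm.var i) = hM.toHull (v i) := by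
  rw [val, AffForm.eval_apply, AffForm.var, zero_smul, add_zero, Finset.sum_eq_single i]
  · simp
  · intro j _ hj
    simp [hj]
  · simp

/-- The values of the forms in `S` at two tuples have the same types. -/
def Agree (S : Finset (AffForm α)) (v v' : α → M) : Prop :=
  ∀ l ∈ S, SameType hM.isDense.coverSubgroup hM.isDense.liftSubgroup (hM.val v l) (hM.val v' l)

variable {hM}

theorem Agree.mono {S T : Finset (AffForm α)} {v v' : α → M} (h : hM.Agree T v v') (hST : S ⊆ T) :
    hM.Agree S v v' := fun l hl => h l (hST hl)

theorem Agree.symm {S : Finset (AffForm α)} {v v' : α → M} (h : hM.Agree S v v') :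
    hM.Agree S v' v := fun l hl => (h l hl).symm

end IsPairStructure

section Relations

variable {M : Type*} [LOP.Structure M] {α : Type*} {n : ℕ} (v : α → M) (xs : Fin n → M)

theorem realize_rel_orient (ts : Fin 3 → LOP.Term (α ⊕ Fin n)) :
    (BoundedFormula.rel (L := LOP) (Sum.inl ORel.orient) ts).Realize v xs ↔
      Orient ((ts 0).realize (Sum.elim v xs)) ((ts 1).realize (Sum.elim v xs))
        ((ts 2).realize (Sum.elim v xs)) := by
  change Structure.RelMap (L := LO) ORel.orient (fun i => (ts i).realize (Sum.elim v xs)) ↔ _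
  rw [Orient]
  apply iff_of_eq
  congr 1
  ext i; fin_cases i <;> rfl

theorem realize_rel_inV (ts : Fin 1 → LOP.Term (α ⊕ Fin n)) :
    (BoundedFormula.rel (L := LOP) (Sum.inr VRel.V) ts).Realize v xs ↔
      InV ((ts 0).realize (Sum.elim v xs)) := by
  change Structure.RelMap symbV (fun i => (ts i).realize (Sum.elim v xs)) ↔ _
  rw [InV]
  apply iff_of_eq
  congr 1
  ext i; fin_cases i; rfl

end Relations

/-! ### Formulas depend on finitely many affine forms -/

section Invariance

universe w

/-- The lift of the value of a term is one of finitely many affine forms, and which one is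
determined by the types of finitely many forms. -/
theorem exists_forms_term {α : Type*} [Fintype α] (t : LOP.Term α) : ∃ S R : Finset (AffForm α),
    ∀ {M : Type w} [LOP.Structure M] [AddCommGroup M] {G : AddSubgroup M} (hM : IsPairStructure M G)
      (v v' : α → M), hM.Agree S v v' →
      ∃ l ∈ R, hM.toHull (t.realize v) = hM.val v l ∧ hM.toHull (t.realize v') = hM.val v' l := by
  classical
  induction t with
  | var i =>
    refine ⟨∅, {AffForm.var i}, fun hM v v' _ => ⟨_, Finset.mem_singleton_self _, ?_, ?_⟩⟩ <;> simp
  | @func n f ts ih =>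
    choose S R h using ih
    rcases f with f | f
    swap
    · exact f.elim
    have hfun : ∀ {M : Type w} [LOP.Structure M] (v : α → M), (Term.func (Sum.inl f) ts).realize v =
        Structure.funMap (L := LO) f fun i => (ts i).realize v := fun v => rfl
    simp only [hfun]
    cases f with
    | zero =>
      refine ⟨∅, {0}, fun hM v v' _ => ⟨_, Finset.mem_singleton_self _, ?_⟩⟩
      simp only [map_zero]
      have := hM.zero
      rw [Subsingleton.elim (fun i => (ts i).realize v) ![],
        Subsingleton.elim (fun i => (ts i).realize v') ![], this, hM.toHull_zero]
      exact ⟨rfl, rfl⟩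
    | neg =>
      refine ⟨S 0 ∪ R 0, R 0 ∪ (R 0).image fun l => (0, 1) - l, fun {M} _ _ G hM v v' hv => ?_⟩
      obtain ⟨l, hl, h1, h2⟩ := h 0 hM v v' (hv.mono Finset.subset_union_left)
      have hneg : ∀ v : α → M, Structure.funMap (L := LO) OFunc.neg (fun i => (ts i).realize v) =
          -(ts 0).realize v := fun v => by
        rw [← hM.neg]
        congr 1
        ext i; fin_cases i; rfl
      rw [hneg, hneg]
      have hs := (hv l (Finset.mem_union_right _ hl)).pos
      rw [← h1, ← h2] at hs
      rcases hM.toHull_neg ((ts 0).realize v) with ⟨h3, h4⟩ | ⟨h3, h4⟩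
      · obtain ⟨h5, h6⟩ := (hM.toHull_neg ((ts 0).realize v')).resolve_right fun H => h4 (hs.2 H.2)
        exact ⟨l, Finset.mem_union_left _ hl, h3.trans h1, h5.trans h2⟩
      · obtain ⟨h5, h6⟩ := (hM.toHull_neg ((ts 0).realize v')).resolve_left fun H => H.2 (hs.1 h4)
        refine ⟨(0, 1) - l, Finset.mem_union_right _ (Finset.mem_image_of_mem _ hl), ?_, ?_⟩
        · rw [h3, h1, map_sub, hM.val_unit, one_smul]
        · rw [h5, h2, map_sub, hM.val_unit, one_smul]
    | add =>
      -- The sign of `l + k - u` decides whether the sum wraps around.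
      refine ⟨S 0 ∪ S 1 ∪ Finset.image₂ (fun l k => l + k - (0, 1)) (R 0) (R 1),
        Finset.image₂ (fun l k => l + k) (R 0) (R 1) ∪ Finset.image₂ (fun l k => l + k - (0, 1)) (R 0) (R 1),
        fun {M} _ _ G hM v v' hv => ?_⟩
      obtain ⟨l, hl, h1, h2⟩ := h 0 hM v v' (hv.mono
        (Finset.subset_union_left.trans Finset.subset_union_left))
      obtain ⟨k, hk, h3, h4⟩ := h 1 hM v v' (hv.mono
        (Finset.subset_union_right.trans Finset.subset_union_left))
      have hadd : ∀ v : α → M, Structure.funMap (L := LO) OFunc.add (fun i => (ts i).realize v) =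
          (ts 0).realize v + (ts 1).realize v := fun v => by
        rw [← hM.add]
        congr 1
        ext i; fin_cases i <;> rfl
      rw [hadd, hadd]
      have hs := (hv (l + k - (0, 1)) (Finset.mem_union_right _
        (Finset.mem_image₂_of_mem hl hk))).neg
      simp only [map_sub, map_add, hM.val_unit, one_smul] at hs
      rw [← h1, ← h2, ← h3, ← h4] at hs
      rcases hM.toHull_add ((ts 0).realize v) ((ts 1).realize v) with ⟨h5, h6⟩ | ⟨h5, h6⟩
      · obtain ⟨h7, -⟩ := (hM.toHull_add ((ts 0).realize v') ((ts 1).realize v')).resolve_right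
          fun H => H.2 (hs.1 h6)
        refine ⟨l + k, Finset.mem_union_left _
          (Finset.mem_image₂_of_mem hl hk), ?_, ?_⟩
        · rw [h5, map_add, h1, h3]
        · rw [h7, map_add, h2, h4]
      · obtain ⟨h7, -⟩ := (hM.toHull_add ((ts 0).realize v') ((ts 1).realize v')).resolve_left
          fun H => h6 (hs.2 H.2)
        refine ⟨l + k - (0, 1), Finset.mem_union_right _
          (Finset.mem_image₂_of_mem hl hk), ?_, ?_⟩
        · rw [h5, map_sub, map_add, h1, h3, hM.val_unit, one_smul]
        · rw [h7, map_sub, map_add, h2, h4, hM.val_unit, one_smul]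

/-- The truth value of a formula is determined by the types of finitely many affine forms. -/
theorem exists_forms_formula {α : Type*} [Fintype α] {n : ℕ} (φ : LOP.BoundedFormula α n) :
    ∃ S : Finset (AffForm (α ⊕ Fin n)), ∀ {M : Type w} [LOP.Structure M] [AddCommGroup M]
      {G : AddSubgroup M} (hM : IsPairStructure M G) (v v' : α → M) (xs xs' : Fin n → M),
      hM.Agree S (Sum.elim v xs) (Sum.elim v' xs') → (φ.Realize v xs ↔ φ.Realize v' xs') := by
  classical
  induction φ with
  | falsum => exact ⟨∅, fun _ _ _ _ _ _ => Iff.rfl⟩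
  | equal s t =>
    obtain ⟨S₁, R₁, h₁⟩ := exists_forms_term.{w} s
    obtain ⟨S₂, R₂, h₂⟩ := exists_forms_term.{w} t
    refine ⟨S₁ ∪ S₂ ∪ Finset.image₂ (fun l k => l - k) R₁ R₂, fun hM v v' xs xs' hv => ?_⟩
    obtain ⟨l, hl, h1, h2⟩ := h₁ hM _ _ (hv.mono
      (Finset.subset_union_left.trans Finset.subset_union_left))
    obtain ⟨k, hk, h3, h4⟩ := h₂ hM _ _ (hv.mono
      (Finset.subset_union_right.trans Finset.subset_union_left))
    have hs := hv (l - k) (Finset.mem_union_right _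
      (Finset.mem_image₂_of_mem hl hk))
    have hpos := hs.pos
    have hneg := hs.neg
    rw [map_sub, map_sub, ← h1, ← h2, ← h3, ← h4] at hpos hneg
    change s.realize _ = t.realize _ ↔ s.realize _ = t.realize _
    rw [← hM.toHull_injective.eq_iff, ← hM.toHull_injective.eq_iff, ← sub_eq_zero,
      ← sub_eq_zero (a := hM.toHull (s.realize (Sum.elim v' xs')))]
    rw [eq_iff_le_not_lt, eq_iff_le_not_lt, ← not_lt, ← not_lt, hpos, hneg]
  | rel R ts =>
    choose S Q h using fun i => exists_forms_term.{w} (ts i)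
    rcases R with R | R
    · cases R with
      | orient =>
      set Q' := Q 0 ∪ Q 1 ∪ Q 2 with hQ'
      refine ⟨S 0 ∪ S 1 ∪ S 2 ∪ Finset.image₂ (fun l k => l - k) Q' Q',
        fun {M} _ _ G hM v v' xs xs' hv => ?_⟩
      rw [realize_rel_orient, realize_rel_orient, hM.orient_iff, hM.orient_iff]
      obtain ⟨l₀, hl₀, h1, h2⟩ := h 0 hM _ _ (hv.mono fun _ hx => by simp [hx])
      obtain ⟨l₁, hl₁, h3, h4⟩ := h 1 hM _ _ (hv.mono fun _ hx => by simp [hx])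
      obtain ⟨l₂, hl₂, h5, h6⟩ := h 2 hM _ _ (hv.mono fun _ hx => by simp [hx])
      have key : ∀ l ∈ Q', ∀ k ∈ Q', (hM.val (Sum.elim v xs) l < hM.val (Sum.elim v xs) k ↔
          hM.val (Sum.elim v' xs') l < hM.val (Sum.elim v' xs') k) := by
        intro l hl k hk
        have := (hv (l - k) (Finset.mem_union_right _
          (Finset.mem_image₂_of_mem hl hk))).neg
        rwa [map_sub, map_sub, sub_neg, sub_neg] at this
      rw [h1, h2, h3, h4, h5, h6]
      have m₀ : l₀ ∈ Q' := by simp [hQ', hl₀]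
      have m₁ : l₁ ∈ Q' := by simp [hQ', hl₁]
      have m₂ : l₂ ∈ Q' := by simp [hQ', hl₂]
      rw [key _ m₀ _ m₁, key _ m₁ _ m₂, key _ m₂ _ m₀]
    · cases R with
      | V =>
      refine ⟨S 0 ∪ Q 0, fun {M} _ _ G hM v v' xs xs' hv => ?_⟩
      obtain ⟨l, hl, h1, h2⟩ := h 0 hM _ _ (hv.mono Finset.subset_union_left)
      rw [realize_rel_inV, realize_rel_inV, ← hM.toHull_mem_iff, ← hM.toHull_mem_iff, h1, h2]
      exact (hv l (Finset.mem_union_right _ hl)).memG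
  | imp φ ψ ih₁ ih₂ =>
    obtain ⟨S₁, h₁⟩ := ih₁
    obtain ⟨S₂, h₂⟩ := ih₂
    refine ⟨S₁ ∪ S₂, fun hM v v' xs xs' hv => ?_⟩
    rw [BoundedFormula.realize_imp, BoundedFormula.realize_imp]
    exact imp_congr (h₁ hM _ _ _ _ (hv.mono Finset.subset_union_left))
      (h₂ hM _ _ _ _ (hv.mono Finset.subset_union_right))
  | @all n φ ih =>
    obtain ⟨S, h⟩ := ih
    -- Separates the coefficient of the quantified variable, bringing the forms into the shape
    -- required by `exists_extension_forms`.
    let split : AffForm (α ⊕ Fin (n + 1)) → ℚ × AffForm (α ⊕ Fin n) := fun l =>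
      (l.1 (Sum.inr (Fin.last n)), (fun i => l.1 (Sum.map id Fin.castSucc i), l.2))
    obtain ⟨S', hS'⟩ := exists_extension_forms.{_, w} (S.image split)
    have hval : ∀ {M : Type w} [LOP.Structure M] [AddCommGroup M]
      {G : AddSubgroup M} (hM : IsPairStructure M G) (v : α → M) (xs : Fin n → M) (a : M) (l),
        hM.val (Sum.elim v (Fin.snoc xs a : Fin (n + 1) → M)) l =
          (split l).1 • hM.toHull a + hM.val (Sum.elim v xs) (split l).2 := by
      intro M _ _ G hM v xs a l
      simp only [IsPairStructure.val, AffForm.eval_apply, Fintype.sum_sum_type, Sum.elim_inl,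
        Sum.elim_inr, Fin.sum_univ_castSucc, Fin.snoc_castSucc, Fin.snoc_last, split, Sum.map_inl,
        Sum.map_inr, id]
      abel
    refine ⟨S', ?_⟩
    have key : ∀ {M : Type w} [LOP.Structure M] [AddCommGroup M]
      {G : AddSubgroup M} (hM : IsPairStructure M G) (v v' : α → M) (xs xs' : Fin n → M),
      hM.Agree S' (Sum.elim v xs) (Sum.elim v' xs') → (∀' φ).Realize v' xs' → (∀' φ).Realize v xs := by
      intro M _ _ G hM v v' xs xs' hv H
      rw [BoundedFormula.realize_all] at H ⊢
      intro a
      obtain ⟨x, hxU, hx0, hx1, hx⟩ := hS' hM.isDensePair _ _ hv _ (hM.toHull_mem a)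
        (hM.toHull_nonneg a) (hM.toHull_lt_unit a)
      obtain ⟨a', rfl⟩ := hM.exists_toHull_eq hxU hx0 hx1
      refine (h hM v v' (Fin.snoc xs a) (Fin.snoc xs' a') fun l hl => ?_).2 (H a')
      rw [hval, hval]
      exact hx _ (Finset.mem_image_of_mem _ hl)
    intro M _ _ G hM v v' xs xs' hv
    exact ⟨key hM v' v xs' xs hv.symm, key hM v v' xs xs' hv⟩

end Invariance

end OrientedGroup

/-! ### Chains and classes give UDTFS with two parameters -/

section Criterion

universe u v w

variable {L : FirstOrder.Language.{u, v}} {n : ℕ}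

/-- The value `(x; b)` of the variables of a partitioned formula. -/
abbrev pairVal {M : Type*} (x : M) (b : Fin n → M) : Unit ⊕ Fin n → M := Sum.elim (fun _ => x) b

/-- A criterion for UDTFS with two parameters: the truth values of the formulas in `Δ` are
determined by those of formulas `C i` which define a chain of sets, of formulas `E j` which define
pairwise disjoint or equal sets, and of formulas without parameters. -/
theorem hasUDTFS_two_of_chain_of_classes {T : L.Theory} {Δ : Finset (L.Formula (Unit ⊕ Fin n))}
    {I J K : Type*} [Finite I] [Finite J] [Finite K] (C : I → L.Formula (Unit ⊕ Fin n))
    (E : J → L.Formula (Unit ⊕ Fin n)) (Q : K → L.Formula Unit)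
    (hC : ∀ (M : Type w) [L.Structure M] [M ⊨ T] (i j : I) (b c : Fin n → M),
      (∀ x, (C i).Realize (pairVal x b) → (C j).Realize (pairVal x c)) ∨
        ∀ x, (C j).Realize (pairVal x c) → (C i).Realize (pairVal x b))
    (hE : ∀ (M : Type w) [L.Structure M] [M ⊨ T] (i j : J) (b c : Fin n → M) (x y : M),
      (E i).Realize (pairVal x b) → (E j).Realize (pairVal x c) → (E i).Realize (pairVal y b) →
        (E j).Realize (pairVal y c))
    (hΔ : ∀ (M : Type w) [L.Structure M] [M ⊨ T], ∀ φ ∈ Δ, ∀ (b : Fin n → M) (x y : M),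
      (∀ i, (C i).Realize (pairVal x b) ↔ (C i).Realize (pairVal y b)) →
      (∀ j, (E j).Realize (pairVal x b) ↔ (E j).Realize (pairVal y b)) →
      (∀ k, (Q k).Realize (fun _ => x) ↔ (Q k).Realize (fun _ => y)) →
      (φ.Realize (pairVal x b) → φ.Realize (pairVal y b))) :
    HasUDTFS.{u, v, w} T Δ 2 := by
  classical
  let own : Unit ⊕ Fin n → (Fin n ⊕ (Fin 2 × Fin n)) ⊕ Unit :=
    Sum.elim (fun _ => Sum.inr ()) fun j => Sum.inl (Sum.inl j)
  let par : Fin 2 → Unit ⊕ Fin n → (Fin n ⊕ (Fin 2 × Fin n)) ⊕ Unit := fun k =>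
    Sum.elim (fun _ => Sum.inr ()) fun j => Sum.inl (Sum.inr (k, j))
  let sub : Option I → I → L.Formula (Fin n ⊕ (Fin 2 × Fin n)) := fun o i =>
    o.elim ⊥ fun i₀ => (((C i₀).relabel (par 0)).imp ((C i).relabel own)).iAlls Unit
  let meet : Option J → J → L.Formula (Fin n ⊕ (Fin 2 × Fin n)) := fun o j =>
    o.elim ⊥ fun j₀ => ((E j₀).relabel (par 1) ⊓ (E j).relabel own : L.Formula _).iExs Unit
  -- `F` reconstructs `φ(a; b)` without `a`: some `x` satisfies `φ(x; b)` and has the same values as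
  -- `a` of all formulas `C`, `E` over `b` and of all `Q`. The values for `a` are recovered from the
  -- two parameters by `sub` and `meet`, and from the finite index set. The option `none` records
  -- that `a` lies in no set of the family.
  let F : Option I × Option J × Set K → L.Formula (Unit ⊕ Fin n) →
      L.Formula (Fin n ⊕ (Fin 2 × Fin n)) := fun w φ =>
    (φ.relabel own ⊓ (Formula.iInf fun i => ((C i).relabel own).iff ((sub w.1 i).relabel Sum.inl)) ⊓
      (Formula.iInf fun j => ((E j).relabel own).iff ((meet w.2.1 j).relabel Sum.inl)) ⊓
      (Formula.iInf fun k => ((Q k).relabel fun _ => Sum.inr ()).iff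
        (if k ∈ w.2.2 then ⊤ else ⊥)) : L.Formula _).iExs Unit
  obtain ⟨N, ⟨e⟩⟩ := Finite.exists_equiv_fin (Option I × Option J × Set K)
  refine ⟨N, fun i => F (e.symm i), fun M _ _ B hB hBne a => ?_⟩
  obtain ⟨o₁, b₁, hb₁, h₁⟩ : ∃ (o : Option I) (c : Fin n → M), c ∈ B ∧
      ∀ b ∈ B, ∀ i, (C i).Realize (pairVal a b) ↔ o.elim False fun i₀ =>
        ∀ x, (C i₀).Realize (pairVal x c) → (C i).Realize (pairVal x b) := by
    by_cases hne : ∃ (i : I) (b : Fin n → M), b ∈ B ∧ (C i).Realize (pairVal a b)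
    · let S : Set (I × (Fin n → M)) := {p | p.2 ∈ B ∧ (C p.1).Realize (pairVal a p.2)}
      have hSfin : S.Finite := (Set.finite_univ.prod hB).subset fun p hp => ⟨trivial, hp.1⟩
      obtain ⟨i, b, hb, hi⟩ := hne
      -- In a chain, a set contains `a` exactly when it includes the smallest member containing `a`;
      -- finiteness of `B` supplies that member.
      obtain ⟨⟨i₀, c⟩, hp, hmin⟩ := hSfin.exists_minimalFor
        (fun p => {x | (C p.1).Realize (pairVal x p.2)}) S ⟨(i, b), hb, hi⟩
      refine ⟨some i₀, c, hp.1, fun b hb i => ⟨fun h => ?_, fun h => h a hp.2⟩⟩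
      rcases hC M i₀ i c b with H | H
      · exact H
      · exact hmin (j := (i, b)) ⟨hb, h⟩ H
    · obtain ⟨b, hb⟩ := hBne
      exact ⟨none, b, hb, fun b hb i => iff_of_false (fun h => hne ⟨i, b, hb, h⟩) id⟩
  obtain ⟨o₂, b₂, hb₂, h₂⟩ : ∃ (o : Option J) (c : Fin n → M), c ∈ B ∧
      ∀ b ∈ B, ∀ j, (E j).Realize (pairVal a b) ↔ o.elim False fun j₀ =>
        ∃ x, (E j₀).Realize (pairVal x c) ∧ (E j).Realize (pairVal x b) := by
    by_cases hne : ∃ (j : J) (b : Fin n → M), b ∈ B ∧ (E j).Realize (pairVal a b)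
    -- Since the sets are disjoint or equal, a set contains `a` exactly when it meets one fixed set
    -- containing `a`.
    · obtain ⟨j₀, c, hc, hj⟩ := hne
      refine ⟨some j₀, c, hc, fun b hb j => ⟨fun h => ⟨a, hj, h⟩, ?_⟩⟩
      rintro ⟨x, hx, hx'⟩
      exact hE M j₀ j c b x a hx hx' hj
    · obtain ⟨b, hb⟩ := hBne
      exact ⟨none, b, hb, fun b hb j => iff_of_false (fun h => hne ⟨j, b, hb, h⟩) id⟩
  refine ⟨e (o₁, o₂, {k | (Q k).Realize fun _ => a}), ![b₁, b₂], ?_, fun φ hφ b hb => ?_⟩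
  · intro k
    fin_cases k
    · exact hb₁
    · exact hb₂
  set W : Fin n ⊕ (Fin 2 × Fin n) → M := Sum.elim b fun kj => ![b₁, b₂] kj.1 kj.2 with hW
  have hown : ∀ f : Unit → M, Sum.elim W f ∘ own = pairVal (f ()) b := fun f => by
    ext (i | i) <;> rfl
  have hpar₀ : ∀ f : Unit → M, Sum.elim W f ∘ par 0 = pairVal (f ()) b₁ := fun f => by
    ext (i | i) <;> rfl
  have hpar₁ : ∀ f : Unit → M, Sum.elim W f ∘ par 1 = pairVal (f ()) b₂ := fun f => by
    ext (i | i) <;> rfl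
  have hunit : ∀ p : M → Prop, (∃ f : Unit → M, p (f ())) ↔ ∃ x, p x := fun p =>
    ⟨fun ⟨f, hf⟩ => ⟨_, hf⟩, fun ⟨x, hx⟩ => ⟨fun _ => x, hx⟩⟩
  have hunit' : ∀ p : M → Prop, (∀ f : Unit → M, p (f ())) ↔ ∀ x, p x := fun p =>
    ⟨fun h x => h fun _ => x, fun h f => h _⟩
  have hsub : ∀ i, (sub o₁ i).Realize W ↔ (C i).Realize (pairVal a b) := fun i => by
    rw [h₁ b hb i]
    cases o₁ with
    | none => exact Formula.realize_bot
    | some i₀ =>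
      simp only [sub, Option.elim, Formula.realize_iAlls, Formula.realize_imp,
        Formula.realize_relabel, hown, hpar₀]
      exact hunit' fun x => (C i₀).Realize (pairVal x b₁) → (C i).Realize (pairVal x b)
  have hmeet : ∀ j, (meet o₂ j).Realize W ↔ (E j).Realize (pairVal a b) := fun j => by
    rw [h₂ b hb j]
    cases o₂ with
    | none => exact Formula.realize_bot
    | some j₀ =>
      simp only [meet, Option.elim, Formula.realize_iExs, Formula.realize_inf,
        Formula.realize_relabel, hown, hpar₁]
      exact hunit fun x => (E j₀).Realize (pairVal x b₂) ∧ (E j).Realize (pairVal x b)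
  have hFreal : (F (o₁, o₂, {k | (Q k).Realize fun _ => a}) φ).Realize W ↔ ∃ x : M,
      ((φ.Realize (pairVal x b) ∧
        ∀ i, (C i).Realize (pairVal x b) ↔ (C i).Realize (pairVal a b)) ∧
        ∀ j, (E j).Realize (pairVal x b) ↔ (E j).Realize (pairVal a b)) ∧
        ∀ k, (Q k).Realize (fun _ => x) ↔ (Q k).Realize (fun _ => a) := by
    have hinl : ∀ f : Unit → M, Sum.elim W f ∘ Sum.inl = W := fun f => rfl
    have hQ : ∀ (f : Unit → M) (k : K), (if k ∈ {k | (Q k).Realize fun _ : Unit => a} then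
        (⊤ : L.Formula ((Fin n ⊕ (Fin 2 × Fin n)) ⊕ Unit)) else ⊥).Realize (Sum.elim W f) ↔
        (Q k).Realize fun _ => a := by
      intro f k
      split_ifs with hk
      · exact iff_of_true (Formula.realize_top.2 trivial) hk
      · exact iff_of_false Formula.realize_bot.1 hk
    have hinr : ∀ f : Unit → M, (Sum.elim W f ∘ fun _ : Unit => Sum.inr ()) = fun _ => f () :=
      fun f => rfl
    simp only [F, Formula.realize_iExs, Formula.realize_inf, Formula.realize_relabel,
      Formula.realize_iInf, Formula.realize_iff, hown, hinl, hsub, hmeet, hQ, hinr]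
    exact hunit fun x => ((φ.Realize (pairVal x b) ∧
        ∀ i, (C i).Realize (pairVal x b) ↔ (C i).Realize (pairVal a b)) ∧
        ∀ j, (E j).Realize (pairVal x b) ↔ (E j).Realize (pairVal a b)) ∧
        ∀ k, (Q k).Realize (fun _ => x) ↔ (Q k).Realize (fun _ => a)
  dsimp only
  rw [Equiv.symm_apply_apply, hFreal]
  constructor
  · exact fun h => ⟨a, ⟨⟨h, fun _ => Iff.rfl⟩, fun _ => Iff.rfl⟩, fun _ => Iff.rfl⟩
  · rintro ⟨x, ⟨⟨h, hc⟩, he⟩, hq⟩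
    exact hΔ M φ hφ b x a hc he hq h

end Criterion

/-! ### Definability of signs and cosets -/

namespace OrientedGroup

open OrientedCover hiding lift

section Definability

universe w

/-- The value of an integral affine form in the universal cover. -/
noncomputable def IsPairStructure.coverVal {M : Type*} [LOP.Structure M] [AddCommGroup M]
    {G : AddSubgroup M} (hM : IsPairStructure M G) {α : Type*} [Fintype α] (v : α → M) :
    ((α → ℤ) × ℤ) →+ hM.isDense.Cover where
  toFun p := ∑ i, p.1 i • OrientedCover.lift _ (v i) + p.2 • unit _
  map_zero' := by simp
  map_add' p q := by
    simp only [Prod.fst_add, Prod.snd_add, Pi.add_apply, add_smul, Finset.sum_add_distrib]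
    abel

variable {α : Type*}

/-- The formula `s < t` for the linear order with least element `0`. -/
def ltFormula (s t : LO.Term α) : LO.Formula α :=
  ∼(t.equal 0) ⊓ ((s.equal 0) ⊔ Relations.formula (L := LO) ORel.orient ![0, s, t])

theorem realize_ltFormula {M : Type*} [LOP.Structure M] [AddCommGroup M] {G : AddSubgroup M}
    (hM : IsPairStructure M G) (s t : LO.Term α) (v : α → M) :
    (ltFormula s t).Realize v ↔
      hM.isDense.toIsOriented.linearOrder.lt (s.realize v) (t.realize v) := by
  have hO : (Relations.formula (L := LO) ORel.orient ![0, s, t]).Realize v ↔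
      Orient 0 (s.realize v) (t.realize v) := by
    rw [Formula.realize_rel, Orient, ← hM.realize_zero v]
    apply iff_of_eq
    congr 1
    ext i; fin_cases i <;> rfl
  rw [hM.isDense.lt_iff, ltFormula, Formula.realize_inf, Formula.realize_not, Formula.realize_sup,
    Formula.realize_equal, Formula.realize_equal, hO, hM.realize_zero]

variable [Fintype α]

/-- The values of an integral affine form are definable: their projections are given by a term, and
the sets where the winding number is at least a given integer by formulas. -/
def IsDefinableForm (p : (α → ℤ) × ℤ) : Prop :=
  ∃ (t : LO.Term α) (θ : ℤ → LO.Formula α), ∀ {M : Type w} [LOP.Structure M] [AddCommGroup M]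
    {G : AddSubgroup M} (hM : IsPairStructure M G) (v : α → M),
    t.realize v = (hM.coverVal v p).elt ∧ ∀ k, (θ k).Realize v ↔ k ≤ (hM.coverVal v p).wind

theorem isDefinableForm_zero : IsDefinableForm.{w} (0 : (α → ℤ) × ℤ) := by
  refine ⟨0, fun k => if k ≤ 0 then ⊤ else ⊥, fun hM v => ⟨?_, fun k => ?_⟩⟩
  · rw [hM.realize_zero, map_zero, zero_elt]
  · dsimp only
    rw [map_zero, zero_wind]
    split_ifs with hk
    · exact iff_of_true (Formula.realize_top.2 trivial) hk
    · exact iff_of_false Formula.realize_bot.1 hk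

section

variable {M : Type*} [LOP.Structure M] [AddCommGroup M] {G : AddSubgroup M}
  (hM : IsPairStructure M G) (v : α → M)

theorem IsPairStructure.coverVal_unit : hM.coverVal v (0, 1) = unit _ := by
  simp [coverVal]

theorem IsPairStructure.coverVal_single [DecidableEq α] (i : α) :
    hM.coverVal v (Pi.single i 1, 0) = OrientedCover.lift _ (v i) := by
  simp only [coverVal, AddMonoidHom.coe_mk, ZeroHom.coe_mk, zero_smul, add_zero]
  rw [Finset.sum_eq_single i]
  · simp
  · intro j _ hj
    simp [hj]
  · simp

end

theorem IsDefinableForm.add_unit {p : (α → ℤ) × ℤ} (h : IsDefinableForm.{w} p) :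
    IsDefinableForm.{w} (p + (0, 1)) := by
  obtain ⟨t, θ, h⟩ := h
  refine ⟨t, fun k => θ (k - 1), fun hM v => ⟨?_, fun k => ?_⟩⟩
  · rw [map_add, hM.coverVal_unit, add_elt, unit_elt, add_zero, (h hM v).1]
  · rw [map_add, hM.coverVal_unit, add_unit_wind, (h hM v).2, sub_le_iff_le_add]

theorem IsDefinableForm.sub_unit {p : (α → ℤ) × ℤ} (h : IsDefinableForm.{w} p) :
    IsDefinableForm.{w} (p - (0, 1)) := by
  obtain ⟨t, θ, h⟩ := h
  refine ⟨t, fun k => θ (k + 1), fun hM v => ⟨?_, fun k => ?_⟩⟩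
  · rw [map_sub, hM.coverVal_unit, sub_elt, unit_elt, sub_zero, (h hM v).1]
  · have := add_unit_wind (hM.coverVal v p - unit _)
    rw [sub_add_cancel] at this
    rw [map_sub, hM.coverVal_unit, (h hM v).2, this]
    omega

/-- The winding number grows by the carry, which is `1` exactly when the projected sum is smaller
than the projection of the first summand, a definable condition. -/
theorem IsDefinableForm.add_single [DecidableEq α] {p : (α → ℤ) × ℤ} (h : IsDefinableForm.{w} p)
    (i : α) : IsDefinableForm.{w} (p + (Pi.single i 1, 0)) := by
  classical
  obtain ⟨t, θ, h⟩ := h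
  refine ⟨t + Term.var i, fun k => θ k ⊔ (θ (k - 1) ⊓ ltFormula (t + Term.var i) t),
    fun hM v => ⟨?_, fun k => ?_⟩⟩
  · rw [map_add, hM.coverVal_single, add_elt, lift_elt, hM.realize_add, (h hM v).1]
    rfl
  · rw [Formula.realize_sup, Formula.realize_inf, realize_ltFormula hM, (h hM v).2, (h hM v).2,
      map_add, hM.coverVal_single, add_wind, lift_wind, lift_elt, hM.realize_add, (h hM v).1,
      Term.realize_var, IsOriented.carry_eq]
    split_ifs with hlt
    · simp only [hlt, and_true]; omega
    · simp only [hlt, and_false, or_false]; omega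

theorem IsDefinableForm.sub_single [DecidableEq α] {p : (α → ℤ) × ℤ} (h : IsDefinableForm.{w} p)
    (i : α) : IsDefinableForm.{w} (p - (Pi.single i 1, 0)) := by
  classical
  obtain ⟨t, θ, h⟩ := h
  refine ⟨t + -Term.var i, fun k => θ (k + 1) ⊔ (θ k ⊓ ∼(ltFormula t (t + -Term.var i))),
    fun hM v => ⟨?_, fun k => ?_⟩⟩
  · rw [map_sub, hM.coverVal_single, sub_elt, lift_elt, hM.realize_add, hM.realize_neg, (h hM v).1,
      sub_eq_add_neg]
    rfl
  · have := add_wind (hM.coverVal v p - OrientedCover.lift _ (v i)) (OrientedCover.lift _ (v i))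
    rw [sub_add_cancel, IsOriented.carry_eq, lift_wind, lift_elt, sub_elt, lift_elt,
      sub_add_cancel] at this
    rw [Formula.realize_sup, Formula.realize_inf, Formula.realize_not, realize_ltFormula hM,
      (h hM v).2, (h hM v).2, map_sub, hM.coverVal_single, hM.realize_add, hM.realize_neg,
      (h hM v).1, Term.realize_var, ← sub_eq_add_neg, this]
    split_ifs with hlt
    · simp only [hlt, not_true_eq_false, and_false, or_false]; omega
    · simp only [hlt, not_false_eq_true, and_true]; omega

theorem isDefinableForm (p : (α → ℤ) × ℤ) : IsDefinableForm.{w} p := by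
  classical
  have step : ∀ e : (α → ℤ) × ℤ, (∀ p, IsDefinableForm.{w} p → IsDefinableForm.{w} (p + e)) →
      (∀ p, IsDefinableForm.{w} p → IsDefinableForm.{w} (p - e)) →
      ∀ (n : ℤ) (p), IsDefinableForm.{w} p → IsDefinableForm.{w} (p + n • e) := by
    intro e h1 h2 n p hp
    induction n using Int.induction_on with
    | zero => simpa using hp
    | succ n ih => rw [add_smul, one_smul, ← add_assoc]; exact h1 _ ih
    | pred n ih => rw [sub_smul, one_smul, ← add_sub_assoc]; exact h2 _ ih
  have hsum : ∀ s : Finset α,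
      IsDefinableForm.{w} (∑ i ∈ s, p.1 i • ((Pi.single i 1, 0) : (α → ℤ) × ℤ)) := by
    intro s
    induction s using Finset.induction_on with
    | empty => exact isDefinableForm_zero
    | insert i s hi ih =>
      rw [Finset.sum_insert hi, add_comm]
      exact step _ (fun _ h => h.add_single i) (fun _ h => h.sub_single i) _ _ ih
  have := step (0, 1) (fun _ h => h.add_unit) (fun _ h => h.sub_unit) p.2 _ (hsum Finset.univ)
  convert this using 1
  ext j
  · simp [Finset.sum_apply, Pi.single_apply, Prod.fst_sum]
  · simp [Prod.snd_sum]

/-- Positivity of an affine form is definable. -/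
theorem exists_formula_pos (l : AffForm α) : ∃ ψ : LOP.Formula α, ∀ {M : Type w} [LOP.Structure M]
    [AddCommGroup M] {G : AddSubgroup M} (hM : IsPairStructure M G) (v : α → M),
    ψ.Realize v ↔ 0 < hM.val v l := by
  classical
  obtain ⟨N, hN, h⟩ := exists_common_multiplier (insert l.2 (Finset.univ.image l.1))
  choose c hc using fun i => (h (l.1 i) (by simp)).1
  obtain ⟨m, hm⟩ := (h l.2 (by simp)).1
  obtain ⟨t, θ, hθ⟩ := isDefinableForm.{w} (c, m)
  -- After clearing denominators the value lies in the cover, where an element is positive if its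
  -- winding number is at least `1`, or at least `0` with nonzero projection.
  refine ⟨LHom.sumInl.onFormula (θ 1 ⊔ (θ 0 ⊓ ∼(t.equal 0))), fun {M} _ _ G hM v => ?_⟩
  have hval : ((hM.coverVal v (c, m) : hM.isDense.Cover) : hM.Hull) = (N : ℚ) • hM.val v l := by
    change DivisibleHull.coeAddMonoidHom hM.isDense.Cover (_ + _) = _
    rw [map_add, map_sum, map_zsmul, IsPairStructure.val, AffForm.eval_apply, smul_add, smul_smul,
      hm, Int.cast_smul_eq_zsmul, Finset.smul_sum]
    congr 1
    refine Finset.sum_congr rfl fun i _ => ?_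
    rw [map_zsmul, smul_smul, hc, Int.cast_smul_eq_zsmul]
    rfl
  rw [LHom.realize_onFormula, Formula.realize_sup, Formula.realize_inf, Formula.realize_not,
    Formula.realize_equal, hM.realize_zero, (hθ hM v).1, (hθ hM v).2, (hθ hM v).2,
    ← smul_pos_iff_of_pos_left (show (0 : ℚ) < N by positivity), ← hval, ← DivisibleHull.mk_zero 1,
    hM.coe_lt_coe, OrientedCover.pos_iff]

theorem exists_formula_eq_zero (l : AffForm α) : ∃ ψ : LOP.Formula α, ∀ {M : Type w}
    [LOP.Structure M] [AddCommGroup M] {G : AddSubgroup M} (hM : IsPairStructure M G) (v : α → M),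
    ψ.Realize v ↔ hM.val v l = 0 := by
  obtain ⟨ψ, h⟩ := exists_formula_pos.{w} l
  obtain ⟨ψ', h'⟩ := exists_formula_pos.{w} (-l)
  refine ⟨∼ψ ⊓ ∼ψ', fun hM v => ?_⟩
  rw [Formula.realize_inf, Formula.realize_not, Formula.realize_not, h hM, h' hM, map_neg, neg_pos,
    not_lt, not_lt, le_antisymm_iff]

/-- Lifts lie in `[0, u)`, so the bound depends only on the coefficients. It turns the quantifier
over all multiples of `u` in `exists_formula_coset` into a finite disjunction. -/
theorem exists_bound (l : AffForm α) : ∃ J : ℕ, ∀ {M : Type w} [LOP.Structure M] [AddCommGroup M]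
    {G : AddSubgroup M} (hM : IsPairStructure M G) (v : α → M),
    |hM.val v l| ≤ (J : ℚ) • hM.hullUnit := by
  obtain ⟨J, hJ⟩ := exists_nat_ge (∑ i, |l.1 i| + |l.2|)
  refine ⟨J, fun hM v => ?_⟩
  have hu := hM.isDensePair.unit_pos.le
  calc |hM.val v l| ≤ (∑ i, |l.1 i| + |l.2|) • hM.hullUnit := by
        rw [IsPairStructure.val, AffForm.eval_apply, add_smul, Finset.sum_smul]
        refine (abs_add_le _ _).trans (add_le_add ((Finset.abs_sum_le_sum_abs _ _).trans
          (Finset.sum_le_sum fun i _ => ?_)) ?_)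
        · rw [abs_smul, abs_of_nonneg (hM.toHull_nonneg (v i))]
          exact smul_le_smul_of_nonneg_left (hM.toHull_lt_unit _).le (abs_nonneg _)
        · rw [abs_smul, abs_of_nonneg hu]
    _ ≤ _ := smul_le_smul_of_nonneg_right hJ hu

/-- The elements `N (z + j u)` with `z` in a definable set and `j` an integer form a definable
set. -/
theorem exists_formula_coset (χ : LOP.Formula Unit) (l : AffForm α) {N : ℕ} (hN : 0 < N) :
    ∃ ψ : LOP.Formula α, ∀ {M : Type w} [LOP.Structure M] [AddCommGroup M] {G : AddSubgroup M}
      (hM : IsPairStructure M G) (v : α → M), ψ.Realize v ↔ ∃ z, χ.Realize (fun _ => z) ∧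
        ∃ j : ℤ, hM.val v l = (N : ℚ) • (hM.toHull z + (j : ℚ) • hM.hullUnit) := by
  obtain ⟨J, hJ⟩ := exists_bound.{w} l
  choose ψ hψ using fun j : Finset.Icc (-(J : ℤ)) J =>
    exists_formula_eq_zero.{w} (α := α ⊕ Unit) (Sum.elim l.1 fun _ => -(N : ℚ), l.2 - N * (j : ℤ))
  refine ⟨(χ.relabel Sum.inr ⊓ Formula.iSup ψ : LOP.Formula (α ⊕ Unit)).iExs Unit,
    fun {M} _ _ G hM v => ?_⟩
  have hval : ∀ (f : Unit → M) (j : ℤ), hM.val (Sum.elim v f)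
      ((Sum.elim l.1 fun _ => -(N : ℚ), l.2 - N * (j : ℤ)) : AffForm (α ⊕ Unit)) = 0 ↔
      hM.val v l = (N : ℚ) • (hM.toHull (f ()) + (j : ℚ) • hM.hullUnit) := by
    intro f j
    rw [← sub_eq_zero (a := hM.val v l)]
    apply iff_of_eq
    congr 1
    simp only [IsPairStructure.val, AffForm.eval_apply, Fintype.sum_sum_type, Sum.elim_inl,
      Sum.elim_inr, Finset.univ_unique, Finset.sum_singleton]
    change _ + -(N : ℚ) • hM.toHull (f ()) + _ = _
    module
  simp only [Formula.realize_iExs, Formula.realize_inf, Formula.realize_relabel,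
    Formula.realize_iSup, hψ _ hM, hval]
  constructor
  · rintro ⟨f, hf, j, hj⟩
    exact ⟨f (), hf, j, hj⟩
  · rintro ⟨z, hz, j, hj⟩
    refine ⟨fun _ => z, hz, ⟨j, ?_⟩, hj⟩
    have hu := hM.isDensePair.unit_pos
    have hN' : (1 : ℚ) ≤ N := by exact_mod_cast hN
    have h1 := hJ hM v
    rw [hj, abs_smul, abs_of_nonneg (zero_le_one.trans hN')] at h1
    have h2 := (one_smul ℚ _).symm.le.trans ((smul_le_smul_of_nonneg_right hN'
      (abs_nonneg (hM.toHull z + (j : ℚ) • hM.hullUnit))).trans h1)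
    rw [abs_le] at h2
    rw [Finset.mem_Icc]
    constructor
    · have h3 : -((J : ℚ) • hM.hullUnit) < (1 + (j : ℚ)) • hM.hullUnit := by
        rw [add_smul, one_smul]
        exact h2.1.trans_lt (add_lt_add_left (hM.toHull_lt_unit z) _)
      rw [← neg_smul] at h3
      have := lt_of_smul_lt_smul_of_nonneg_right h3 hu.le
      have : -(J : ℤ) < 1 + j := by exact_mod_cast this
      omega
    · have h3 : (j : ℚ) • hM.hullUnit ≤ (J : ℚ) • hM.hullUnit :=
        (le_add_of_nonneg_left (hM.toHull_nonneg z)).trans h2.2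
      have := le_of_smul_le_smul_of_pos_right h3 hu
      exact_mod_cast this

theorem IsPairStructure.mem_coverSubgroup_iff {M : Type*} [LOP.Structure M] [AddCommGroup M]
    {G : AddSubgroup M} (hM : IsPairStructure M G) (x : hM.Hull) :
    x ∈ hM.isDense.coverSubgroup ↔ ∃ (z : M) (j : ℤ), x = hM.toHull z + (j : ℚ) • hM.hullUnit := by
  constructor
  · rintro ⟨y, rfl⟩
    refine ⟨y.elt, y.wind, ?_⟩
    conv_lhs => rw [eq_lift_add y, map_add, map_zsmul]
    rw [Int.cast_smul_eq_zsmul]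
    rfl
  · rintro ⟨z, j, rfl⟩
    rw [AddSubgroup.add_smul_mem_iff _ (hM.isDensePair.le hM.isDensePair.unit_mem) j rfl]
    exact hM.toHull_mem z

theorem IsPairStructure.mem_liftSubgroup_iff {M : Type*} [LOP.Structure M] [AddCommGroup M]
    {G : AddSubgroup M} (hM : IsPairStructure M G) (x : hM.Hull) : x ∈ hM.isDense.liftSubgroup ↔
      ∃ z : M, InV z ∧ ∃ j : ℤ, x = hM.toHull z + (j : ℚ) • hM.hullUnit := by
  constructor
  · intro hx
    obtain ⟨z, j, rfl⟩ := (hM.mem_coverSubgroup_iff x).1 (hM.isDensePair.le hx)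
    rw [AddSubgroup.add_smul_mem_iff _ hM.isDensePair.unit_mem j rfl, hM.toHull_mem_iff] at hx
    exact ⟨z, hx, j, rfl⟩
  · rintro ⟨z, hz, j, rfl⟩
    rw [AddSubgroup.add_smul_mem_iff _ hM.isDensePair.unit_mem j rfl, hM.toHull_mem_iff]
    exact hz

theorem exists_formula_mem_smul_coverSubgroup (l : AffForm α) {N : ℕ} (hN : 0 < N) :
    ∃ ψ : LOP.Formula α, ∀ {M : Type w} [LOP.Structure M] [AddCommGroup M] {G : AddSubgroup M}
      (hM : IsPairStructure M G) (v : α → M), ψ.Realize v ↔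
        ∃ g ∈ hM.isDense.coverSubgroup, hM.val v l = (N : ℚ) • g := by
  obtain ⟨ψ, h⟩ := exists_formula_coset.{w} ⊤ l hN
  refine ⟨ψ, fun hM v => ?_⟩
  simp only [h hM, Formula.realize_top, true_and, hM.mem_coverSubgroup_iff]
  constructor
  · rintro ⟨z, j, h⟩
    exact ⟨_, ⟨z, j, rfl⟩, h⟩
  · rintro ⟨_, ⟨z, j, rfl⟩, h⟩
    exact ⟨z, j, h⟩

theorem exists_formula_mem_smul_liftSubgroup (l : AffForm α) {N : ℕ} (hN : 0 < N) :
    ∃ ψ : LOP.Formula α, ∀ {M : Type w} [LOP.Structure M] [AddCommGroup M] {G : AddSubgroup M}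
      (hM : IsPairStructure M G) (v : α → M), ψ.Realize v ↔
        ∃ g ∈ hM.isDense.liftSubgroup, hM.val v l = (N : ℚ) • g := by
  obtain ⟨ψ, h⟩ := exists_formula_coset.{w} (Relations.formula₁ symbV (Term.var ())) l hN
  refine ⟨ψ, fun hM v => ?_⟩
  simp only [h hM, Formula.realize_rel₁, Term.realize_var, hM.mem_liftSubgroup_iff]
  constructor
  · rintro ⟨z, hz, j, h⟩
    exact ⟨_, ⟨z, hz, j, rfl⟩, h⟩
  · rintro ⟨_, ⟨z, hz, j, rfl⟩, h⟩
    exact ⟨z, hz, j, h⟩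

/-- The truth values of finitely many formulas are determined by the types of finitely many affine
forms. -/
theorem exists_forms_finset (Δ : Finset (LOP.Formula α)) : ∃ S : Finset (AffForm α),
    ∀ {M : Type w} [LOP.Structure M] [AddCommGroup M] {G : AddSubgroup M} (hM : IsPairStructure M G)
      (v v' : α → M), hM.Agree S v v' → ∀ φ ∈ Δ, (φ.Realize v → φ.Realize v') := by
  classical
  choose S hS using fun φ : LOP.Formula α => exists_forms_formula.{w} φ
  refine ⟨Δ.biUnion fun φ => (S φ).image fun l => (l.1 ∘ Sum.inl, l.2),
    fun {M} _ _ G hM v v' hv φ hφ => (hS φ hM v v' default default fun l hl => ?_).1⟩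
  have := hv (l.1 ∘ Sum.inl, l.2) (Finset.mem_biUnion.2 ⟨φ, hφ, Finset.mem_image_of_mem _ hl⟩)
  have hval : ∀ v : α → M, hM.val (Sum.elim v default) l = hM.val v (l.1 ∘ Sum.inl, l.2) := by
    intro v
    simp [IsPairStructure.val, AffForm.eval_apply, Fintype.sum_sum_type]
  rwa [hval, hval]

end Definability

end OrientedGroup

/-! ### Application of the criterion to pairs -/

namespace OrientedGroup

section Main

universe w

variable {n : ℕ}

/-- The affine form, divided by the coefficient of the object variable. -/
noncomputable def normalized (l : AffForm (Unit ⊕ Fin n)) : AffForm (Unit ⊕ Fin n) :=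
  (l.1 (Sum.inl ()))⁻¹ • l

namespace IsPairStructure

variable {M : Type*} [LOP.Structure M] [AddCommGroup M] {G : AddSubgroup M}
  (hM : IsPairStructure M G)

theorem val_pairVal (x : M) (b : Fin n → M) (l : AffForm (Unit ⊕ Fin n)) :
    hM.val (pairVal x b) l = l.1 (Sum.inl ()) • hM.toHull x +
      hM.val b ((fun j => l.1 (Sum.inr j), l.2) : AffForm (Fin n)) := by
  simp [IsPairStructure.val, AffForm.eval_apply, Fintype.sum_sum_type, add_assoc]

theorem val_eq_smul_normalized {l : AffForm (Unit ⊕ Fin n)} (hl : l.1 (Sum.inl ()) ≠ 0)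
    (v : Unit ⊕ Fin n → M) : hM.val v l = l.1 (Sum.inl ()) • hM.val v (normalized l) := by
  rw [normalized, map_smul, smul_inv_smul₀ hl]

theorem monotone_val_normalized (b : Fin n → M) (l : AffForm (Unit ⊕ Fin n)) {x y : M}
    (hxy : hM.toHull x ≤ hM.toHull y) :
    hM.val (pairVal x b) (normalized l) ≤ hM.val (pairVal y b) (normalized l) := by
  rw [val_pairVal, val_pairVal]
  refine add_le_add_left (smul_le_smul_of_nonneg_left hxy ?_) _
  -- The coefficient of `x` after normalization is `1`, or `0` when it was `0`, because `0⁻¹ = 0`;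
  -- it is never negative.
  by_cases hl : l.1 (Sum.inl ()) = 0 <;> simp [normalized, hl]

theorem val_normalized_sub {l : AffForm (Unit ⊕ Fin n)} (hl : l.1 (Sum.inl ()) ≠ 0)
    (b : Fin n → M) (x y : M) : hM.val (pairVal y b) (normalized l) -
      hM.val (pairVal x b) (normalized l) = hM.toHull y - hM.toHull x := by
  rw [val_pairVal, val_pairVal]
  simp [normalized, inv_mul_cancel₀ hl]

end IsPairStructure

theorem chain_of_monotone {α β : Type*} [LinearOrder β] (t : α → β) {p q : α → Prop}
    (hp : ∀ x y, t x ≤ t y → p x → p y) (hq : ∀ x y, t x ≤ t y → q x → q y) :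
    (∀ x, p x → q x) ∨ ∀ x, q x → p x := by
  by_contra! h
  obtain ⟨⟨x, hx, hx'⟩, y, hy, hy'⟩ := h
  rcases le_total (t x) (t y) with h | h
  · exact hy' (hp x y h hx)
  · exact hx' (hq y x h hy)

/-- The theories of dense pairs of divisible oriented abelian groups have the VC 2 property. -/
theorem hasVCProperty_pairTheory (e₁ e₂ : Nat.Primes → ℕ∞) :
    HasVCProperty.{0, 0, w} (pairTheory 0 e₁ 0 e₂) 2 := by
  classical
  intro n Δ
  obtain ⟨S, hS⟩ := exists_forms_finset.{w} Δ
  obtain ⟨N, hN, hNS⟩ := exists_common_multiplier (S.image fun l => l.1 (Sum.inl ()))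
  replace hNS : ∀ l ∈ S, (∃ j : ℤ, (N : ℚ) * l.1 (Sum.inl ()) = j) ∧
      (l.1 (Sum.inl ()) ≠ 0 → ∃ j : ℤ, (N : ℚ) = j * l.1 (Sum.inl ())) :=
    fun l hl => hNS _ (Finset.mem_image_of_mem _ hl)
  choose pos hpos using fun l : AffForm (Unit ⊕ Fin n) => exists_formula_pos.{w} l
  choose modG hmodG using fun l : AffForm (Unit ⊕ Fin n) =>
    exists_formula_mem_smul_liftSubgroup.{w} l hN
  choose modU hmodU using fun l : AffForm Unit => exists_formula_mem_smul_coverSubgroup.{w} l hN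
  -- The second component is the residue `m` in `N² g + m u`. Dividing by the coefficient `c` of `x`
  -- turns the decomposition into `(m/c) u + N (N/c) g`, so all resulting conditions concern cosets
  -- of the same subgroup `N G`.
  let J := {l // l ∈ S ∧ l.1 (Sum.inl ()) ≠ 0} × Fin (N * N)
  have : Finite {l // l ∈ S ∧ l.1 (Sum.inl ()) ≠ 0} :=
    (S.finite_toSet.subset fun l hl => hl.1).to_subtype
  -- The conditions are `> 0` and `≥ 0` for the normalized form; both define final segments in `x`.
  let C : S × Bool → LOP.Formula (Unit ⊕ Fin n) := fun i =>
    if i.2 then pos (normalized i.1.1) else ∼(pos (-normalized i.1.1))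
  let E : J → LOP.Formula (Unit ⊕ Fin n) := fun i =>
    modG (normalized i.1.1 - (0, (i.1.1.1 (Sum.inl ()))⁻¹ * (i.2 : ℕ)))
  let Q : Fin N → LOP.Formula Unit := fun m => modU (AffForm.var () - (0, ((m : ℕ) : ℚ)))
  have hE : ∀ {M : Type w} [LOP.Structure M] [AddCommGroup M] {G : AddSubgroup M}
      (hM : IsPairStructure M G) (i : J) (x : M) (b : Fin n → M), (E i).Realize (pairVal x b) ↔
        ∃ g ∈ hM.isDense.liftSubgroup, hM.val (pairVal x b) (normalized i.1.1) =
          ((i.1.1.1 (Sum.inl ()))⁻¹ * (i.2 : ℕ)) • hM.hullUnit + (N : ℚ) • g := by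
    intro M _ _ G hM i x b
    rw [hmodG _ hM, map_sub, hM.val_unit]
    simp only [sub_eq_iff_eq_add']
  have hQ : ∀ {M : Type w} [LOP.Structure M] [AddCommGroup M] {G : AddSubgroup M}
      (hM : IsPairStructure M G) (m : Fin N) (x : M), (Q m).Realize (fun _ => x) ↔
        ∃ g ∈ hM.isDense.coverSubgroup, hM.toHull x =
          ((m : ℕ) : ℚ) • hM.hullUnit + (N : ℚ) • g := by
    intro M _ _ G hM m x
    rw [hmodU _ hM, map_sub, hM.val_unit, hM.val_var]
    simp only [sub_eq_iff_eq_add']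
  refine hasUDTFS_two_of_chain_of_classes C E Q ?_ ?_ ?_
  · intro M _ hT i j b c
    obtain ⟨_, G, hM⟩ := exists_isPairStructure hT
    have hup : ∀ (i : S × Bool) (b : Fin n → M) (x y : M), hM.toHull x ≤ hM.toHull y →
        (C i).Realize (pairVal x b) → (C i).Realize (pairVal y b) := by
      rintro ⟨l, _ | _⟩ b x y hxy h
      · simp only [C, Bool.false_eq_true, if_false, Formula.realize_not, hpos _ hM, map_neg,
          neg_pos, not_lt] at h ⊢
        exact h.trans (hM.monotone_val_normalized b l hxy)
      · simp only [C, if_true, hpos _ hM] at h ⊢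
        exact h.trans_le (hM.monotone_val_normalized b l hxy)
    exact chain_of_monotone hM.toHull (hup i b) (hup j c)
  · intro M _ hT i j b c x y h1 h2 h3
    obtain ⟨_, G, hM⟩ := exists_isPairStructure hT
    rw [hE hM] at h1 h2 h3 ⊢
    obtain ⟨g₁, hg₁, h1⟩ := h1
    obtain ⟨g₂, hg₂, h2⟩ := h2
    obtain ⟨g₃, hg₃, h3⟩ := h3
    -- Both normalized forms change by `y - x` when `x` is replaced by `y`, and the first coset
    -- condition gives `y - x = N (g₃ - g₁)`.
    refine ⟨g₂ + (g₃ - g₁), add_mem hg₂ (sub_mem hg₃ hg₁), ?_⟩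
    have h4 := hM.val_normalized_sub i.1.2.2 b x y
    have h5 := hM.val_normalized_sub j.1.2.2 c x y
    rw [← h4, h1, h2, h3, sub_eq_iff_eq_add] at h5
    rw [h5]
    module
  · intro M _ hT φ hφ b x y hCxy hExy hQxy
    obtain ⟨_, G, hM⟩ := exists_isPairStructure hT
    refine hS hM _ _ (fun l hl => ?_) φ hφ
    by_cases hl0 : l.1 (Sum.inl ()) = 0
    · rw [hM.val_pairVal, hM.val_pairVal, hl0, zero_smul, zero_smul]
      exact SameType.refl _ _ _
    have hp : 0 < hM.val (pairVal x b) (normalized l) ↔ 0 < hM.val (pairVal y b) (normalized l) := by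
      simpa only [C, if_true, hpos _ hM] using hCxy (⟨l, hl⟩, true)
    have hn : hM.val (pairVal x b) (normalized l) < 0 ↔ hM.val (pairVal y b) (normalized l) < 0 := by
      simpa only [C, Bool.false_eq_true, if_false, Formula.realize_not, hpos _ hM, map_neg, neg_pos,
        not_iff_not] using hCxy (⟨l, hl⟩, false)
    obtain ⟨⟨j₁, hj₁⟩, hj⟩ := hNS l hl
    obtain ⟨j, hj⟩ := hj hl0
    refine ⟨?_, ?_, ?_, ?_⟩
    · rw [hM.val_eq_smul_normalized hl0, hM.val_eq_smul_normalized hl0]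
      rcases lt_or_gt_of_ne hl0 with h | h
      · rw [smul_pos_iff_of_neg_left h, smul_pos_iff_of_neg_left h, hn]
      · rw [smul_pos_iff_of_pos_left h, smul_pos_iff_of_pos_left h, hp]
    · rw [hM.val_eq_smul_normalized hl0, hM.val_eq_smul_normalized hl0]
      rcases lt_or_gt_of_ne hl0 with h | h
      · rw [smul_neg_iff_of_neg_left h, smul_neg_iff_of_neg_left h, hp]
      · rw [smul_neg_iff_of_pos_left h, smul_neg_iff_of_pos_left h, hn]
    -- For membership in `U`, only the residue `m` of `x` matters: the coefficient times `N` is an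
    -- integer, so the part in `N U` contributes an element of `U`.
    · obtain ⟨g, hg, m, hm, hgm⟩ := AddSubgroup.exists_eq_smul_add_smul_of_lt _
        (hM.isDensePair.le hM.isDensePair.unit_mem) hN
        (hM.isDensePair.exists_U N hN _ (hM.toHull_mem x))
      rw [add_comm] at hgm
      obtain ⟨g', hg', hgm'⟩ := (hQ hM ⟨m, hm⟩ y).1
        ((hQxy ⟨m, hm⟩).1 ((hQ hM ⟨m, hm⟩ x).2 ⟨g, hg, hgm⟩))
      have key : ∀ g ∈ hM.isDense.coverSubgroup, ∀ r : hM.Hull,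
          l.1 (Sum.inl ()) • ((m : ℚ) • hM.hullUnit + (N : ℚ) • g) + r ∈ hM.isDense.coverSubgroup ↔
          l.1 (Sum.inl ()) • ((m : ℚ) • hM.hullUnit) + r ∈ hM.isDense.coverSubgroup := by
        intro g hg r
        rw [← AddSubgroup.add_smul_mem_iff _ hg j₁ hj₁
          (a := l.1 (Sum.inl ()) • ((m : ℚ) • hM.hullUnit) + r)]
        apply iff_of_eq
        congr 1
        module
      rw [hM.val_pairVal, hM.val_pairVal, hgm, hgm', key g hg, key g' hg']
    · have key : ∀ x y : M, (∀ i, (E i).Realize (pairVal x b) ↔ (E i).Realize (pairVal y b)) →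
          hM.val (pairVal x b) l ∈ hM.isDense.liftSubgroup →
          hM.val (pairVal y b) l ∈ hM.isDense.liftSubgroup := by
        intro x y hxy hx
        obtain ⟨g, hg, m, hm, hgm⟩ := AddSubgroup.exists_eq_smul_add_smul_of_lt _
          hM.isDensePair.unit_mem (Nat.mul_pos hN hN)
          (hM.isDensePair.exists_G _ (Nat.mul_pos hN hN) _ hx)
        -- One factor `N` absorbs the division by the coefficient; the other remains, so the coset
        -- is one of `N G`.
        have h1 : (l.1 (Sum.inl ()))⁻¹ * (N * N) = N * j := by rw [hj]; field_simp
        obtain ⟨g', hg', h2⟩ := (hE hM (⟨l, hl, hl0⟩, ⟨m, hm⟩) y b).1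
          ((hxy (⟨l, hl, hl0⟩, ⟨m, hm⟩)).1 ((hE hM (⟨l, hl, hl0⟩, ⟨m, hm⟩) x b).2
            ⟨(j : ℚ) • g, by rw [Int.cast_smul_eq_zsmul]; exact zsmul_mem hg j, by
              rw [normalized, map_smul, hgm, smul_add, smul_smul, smul_smul, smul_smul, ← h1]
              push_cast
              rw [add_comm]⟩))
        have h3 : hM.val (pairVal y b) l = (0 + (m : ℚ) • hM.hullUnit) +
            ((N : ℚ) * l.1 (Sum.inl ())) • g' := by
          rw [hM.val_eq_smul_normalized hl0, h2, smul_add, smul_smul, smul_smul, zero_add,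
            mul_inv_cancel_left₀ hl0, mul_comm (N : ℚ)]
        rw [h3, AddSubgroup.add_smul_mem_iff _ hg' j₁ hj₁,
          AddSubgroup.add_smul_mem_iff _ hM.isDensePair.unit_mem m (by simp)]
        exact zero_mem _
      exact ⟨key x y hExy, key y x fun i => (hExy i).symm⟩

end Main

end OrientedGroup

theorem theorem1p3 :
    HasVCProperty (OrientedGroup.pairTheory 0 0 0 0) 2 ∧
    ∀ e : Nat.Primes → ℕ∞, e = 0 ∨ e = ⊤ →
      HasVCProperty (OrientedGroup.pairTheory 0 ⊤ 0 e) 2 :=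
  ⟨OrientedGroup.hasVCProperty_pairTheory 0 0,
    fun e _ => OrientedGroup.hasVCProperty_pairTheory ⊤ e⟩
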